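/- For a partition $\lambda=(\lambda_1\ge\dots\ge\lambda_d\ge 0)$ with at most $d$ parts, write $|\lambda|=\sum_i\lambda_i$ and $\bar\lambda=(\lambda_1/|\lambda|,\dots,\lambda_d/|\lambda|)$, and let $U_\lambda$ be the irreducible representation of the unitary group $\mathrm U(d)$ with highest weight $\lambda$, realised as the image of a Young symmetriser of shape $\lambda$ acting on $(\mathbb C^d)^{\otimes|\lambda|}$. The Littlewood--Richardson coefficient $c_{\mu\nu}^{\lambda}$ is the multiplicity of $U_\lambda$ in $U_\mu\otimes U_\nu$, that is, $c_{\mu\nu}^{\lambda}=\dim\operatorname{Hom}_{\mathrm U(d)}(U_\lambda,U_\mu\otimes U_\nu)$. For a density operator $A$ on $\mathbb C^d$ (a positive semidefinite operator of trace one), let $\operatorname{Spec}A\in\mathbb R^d$ be the vector of its eigenvalues with multiplicity in nonincreasing order. Theorem. Let $A$ and $B$ be density operators on $\mathbb C^d$, let $p\in[0,1]$, and let $C=pA+(1-p)B$. Then there are sequences $(\mu_j)$, $(\nu_j)$, $(\lambda_j)$ of partitions with at most $d$ parts such that $c_{\mu_j\nu_j}^{\lambda_j}\neq 0$ for all $j$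 and $$\lim_{j\to\infty}\bar\mu_j=\operatorname{Spec}A,\qquad \lim_{j\to\infty}\bar\nu_j=\operatorname{Spec}B,\qquad \lim_{j\to\infty}\bar\lambda_j=\operatorname{Spec}C.$$ -/

import Mathlib

open scoped TensorProduct Matrix Topology ComplexOrder

noncomputable section

/-- Density operators on `ℂ^d`: positive semidefinite matrices of trace one. -/
structure DensityOperator (d : ℕ) where
  toMatrix : Matrix (Fin d) (Fin d) ℂ
  posSemidef : toMatrix.PosSemidef
  trace_eq_one : toMatrix.trace = 1

namespace DensityOperator

/-- The spectrum of a density operator: its eigenvalues with multiplicity, in nonincreasing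
order. -/
def spec {d : ℕ} (A : DensityOperator d) (i : Fin d) : ℝ :=
  A.posSemidef.isHermitian.eigenvalues₀ (Fin.cast (Fintype.card_fin d).symm i)

/-- The mixture `pA + (1-p)B` with weight `p ∈ [0,1]`. -/
def mix {d : ℕ} (p : Set.Icc (0 : ℝ) 1) (A B : DensityOperator d) : DensityOperator d where
  toMatrix := (p : ℝ) • A.toMatrix + (1 - (p : ℝ)) • B.toMatrix
  posSemidef :=
    (A.posSemidef.smul p.2.1).add (B.posSemidef.smul (sub_nonneg.2 p.2.2))
  trace_eq_one := by
    rw [Matrix.trace_add, Matrix.trace_smul, Matrix.trace_smul, A.trace_eq_one, B.trace_eq_one,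
      ← add_smul, add_sub_cancel, one_smul]

end DensityOperator

/-- Young frames with at most `d` rows (the first column has length at most `d`). -/
def YoungFrame (d : ℕ) : Type := {μ : YoungDiagram // μ.colLen 0 ≤ d}

/-- The normalised frame `(μ₁/|μ|, …, μ_d/|μ|)`. -/
def YoungFrame.normalised {d : ℕ} (μ : YoungFrame d) (i : Fin d) : ℝ :=
  (μ.1.rowLen i : ℝ) / (μ.1.card : ℝ)

/-- The tensor power of `ℂ^d` with tensor factors labelled by `ι`. -/
abbrev QuditSpace (d : ℕ) (ι : Type) : Type := ⨂[ℂ] _ : ι, (Fin d → ℂ)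

/-- The action `g ↦ g ⊗ ⋯ ⊗ g` of `U(d)` on a tensor power of `ℂ^d`. -/
def unitaryAction (d : ℕ) (ι : Type) :
    Representation ℂ (Matrix.unitaryGroup (Fin d) ℂ) (QuditSpace d ι) where
  toFun g := PiTensorProduct.map fun _ => Matrix.toLin' (g : Matrix (Fin d) (Fin d) ℂ)
  map_one' := by
    simp [Matrix.toLin'_one]
    rfl
  map_mul' g h := by
    rw [← PiTensorProduct.map_mul]
    simp only [Matrix.UnitaryGroup.mul_val, Matrix.toLin'_mul]
    rfl

/-- The action of the permutations of `ι` on a tensor power, by permuting the factors. -/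
def permAction (d : ℕ) (ι : Type) :
    Representation ℂ (Equiv.Perm ι) (QuditSpace d ι) where
  toFun σ := (PiTensorProduct.reindex ℂ (fun _ : ι => Fin d → ℂ) σ).toLinearMap
  map_one' := by
    ext x
    simp
    rfl
  map_mul' σ τ := by
    ext x
    simp [Equiv.Perm.mul_def]
    rfl

/-- The row symmetriser: the sum of all permutations of the boxes preserving every row.
The boxes themselves serve as labels; a numbering `1, …, k` of the boxes (a tableau `T`)
identifies this with the element `r_T` of the group algebra of `S_k`. -/
def rowSymmetriser (μ : YoungDiagram) : MonoidAlgebra ℂ (Equiv.Perm μ.cells) :=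
  ∑ σ : Equiv.Perm μ.cells with ∀ x, (σ x).1.1 = x.1.1, MonoidAlgebra.single σ 1

/-- The column antisymmetriser: the signed sum of all permutations of the boxes preserving every
column. -/
def columnAntisymmetriser (μ : YoungDiagram) : MonoidAlgebra ℂ (Equiv.Perm μ.cells) :=
  ∑ σ : Equiv.Perm μ.cells with ∀ x, (σ x).1.2 = x.1.2,
    MonoidAlgebra.single σ ((Equiv.Perm.sign σ : ℤ) : ℂ)

/-- The Young symmetriser `e = r c`. -/
def youngSymmetriser (μ : YoungDiagram) : MonoidAlgebra ℂ (Equiv.Perm μ.cells) :=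
  rowSymmetriser μ * columnAntisymmetriser μ

/-- The operator by which an element of the group algebra of the permutations acts commutes with
the action of `U(d)`. -/
lemma permAction_comm (d : ℕ) (ι : Type) (a : MonoidAlgebra ℂ (Equiv.Perm ι))
    (g : Matrix.unitaryGroup (Fin d) ℂ) (v : QuditSpace d ι) :
    (permAction d ι).asAlgebraHom a (unitaryAction d ι g v) =
      unitaryAction d ι g ((permAction d ι).asAlgebraHom a v) := by
  induction a using MonoidAlgebra.induction_on with
  | of σ =>
    simp only [MonoidAlgebra.of_apply, Representation.asAlgebraHom_single_one]
    exact (PiTensorProduct.map_reindex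
      (fun _ => Matrix.toLin' (g : Matrix (Fin d) (Fin d) ℂ)) σ v).symm
  | add a b ha hb => simp [ha, hb]
  | smul r a ha => simp [ha]

/-- The irreducible representation `U_μ` of `U(d)` with highest weight `μ`, by Weyl's tensorial
construction: the image `e (ℂ^d)^{⊗k}` of the Young symmetriser. -/
def weylModule {d : ℕ} (μ : YoungFrame d) :
    Subrepresentation (unitaryAction d μ.1.cells) where
  toSubmodule :=
    LinearMap.range ((permAction d μ.1.cells).asAlgebraHom (youngSymmetriser μ.1))
  apply_mem_toSubmodule := by
    rintro g _ ⟨v, rfl⟩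
    exact ⟨unitaryAction d _ g v, permAction_comm d _ _ g v⟩

/-- The Littlewood–Richardson coefficient `c_{μν}^λ`: the multiplicity of `U_λ` in `U_μ ⊗ U_ν`,
that is, the dimension of `Hom_{U(d)}(U_λ, U_μ ⊗ U_ν)`. -/
def littlewoodRichardson {d : ℕ} (μ ν lam : YoungFrame d) : ℕ :=
  Module.finrank ℂ (Representation.IntertwiningMap (weylModule lam).toRepresentation
    ((weylModule μ).toRepresentation.tprod (weylModule ν).toRepresentation))

end

/-! The theorem rests on spectrum estimation: in `A^{⊗k}` nearly all weight lies on irreducible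
components whose frame, divided by `k`, is close to Spec A. Let 0 < p < 1 and suppose that every
coefficient vanishes for frames near the three spectra. A typical term in the expansion of `C^{⊗k}`
is a product of `m` factors A and `k - m` factors B, with both numbers large. Such a product is
concentrated on near frames for μ and ν, and the vanishing coefficients then keep it away from near
frames for λ. So `C^{⊗k}` would keep a fixed fraction of its weight away from Spec C, contradicting
the estimate for C.

No isotypic decomposition is needed. The projections `QA`, `QB`, `QC` onto the joint kernels of all
relabelled Young symmetrisers with near frames (their adjoints for C) take its place.
`sumKron_youngMat_mul_eq_zero` turns a vanishing coefficient into an operator identity, and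
`le_trace_of_littlewoodRichardson_eq_zero` turns these identities into `(1 - QA) ⊗ (1 - QB) ≤ QC` up
to relabelling.

The estimate `exists_trace_bound` has two ingredients. By `sum_diag_le`, cyclic subspaces generated
by extremal highest weight vectors can be split off one at a time; each has dimension at most
`(k+1)^(d²)`, so the weight of a projection is at most this polynomial times the weight of words
whose content is a highest weight in it. For far contents the Chernoff bound makes this small. By
`IsHighestWeight.exists_youngMat_ne_zero`, no highest weight vector of near weight lies in the joint
kernel: highest weight vectors of equal weight have proportional expectations of permutation
invariant operators, which permits comparison with the explicit vector `specht`.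

At p = 0 or p = 1 a typical term has no factor of one of the states, so the argument says nothing
about its frame. There λ = μ + ν is taken, with the sizes of μ and ν of different orders; the
coefficient is nonzero by `littlewoodRichardson_add_ne_zero`. -/

noncomputable section

set_option linter.unusedSectionVars false

/-! ### Matrices on tensor powers in the basis of words -/

section Words

variable {d : ℕ} {ι κ ω : Type} [Fintype ι] [DecidableEq ι] [Fintype κ] [DecidableEq κ]
  [Fintype ω] [DecidableEq ω]

/-- The matrix, in the basis of words, of the relabelling of tensor factors along `τ`. -/
def permMat (d : ℕ) (τ : ι ≃ κ) : Matrix (κ → Fin d) (ι → Fin d) ℂ :=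
  Matrix.of fun g f => if g ∘ τ = f then 1 else 0

lemma permMat_mulVec (τ : ι ≃ κ) (y : (ι → Fin d) → ℂ) (g : κ → Fin d) :
    (permMat d τ *ᵥ y) g = y (g ∘ τ) := by
  simp [permMat, Matrix.mulVec, dotProduct]

lemma permMat_mul_apply {m : Type*} (τ : ι ≃ κ) (M : Matrix (ι → Fin d) m ℂ) (g : κ → Fin d)
    (h : m) : (permMat d τ * M) g h = M (g ∘ τ) h := by
  simp [permMat, Matrix.mul_apply]

lemma permMat_conjTranspose (τ : ι ≃ κ) : (permMat d τ)ᴴ = permMat d τ.symm := by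
  ext f g
  simp only [permMat, Matrix.conjTranspose_apply, Matrix.of_apply]
  have : g ∘ τ = f ↔ f ∘ τ.symm = g :=
    ⟨fun h => by rw [← h]; ext x; simp, fun h => by rw [← h]; ext x; simp⟩
  simp [this, apply_ite]

lemma mul_permMat_apply {m : Type*} (τ : ι ≃ κ) (M : Matrix m (κ → Fin d) ℂ) (h : m)
    (f : ι → Fin d) : (M * permMat d τ) h f = M h (f ∘ τ.symm) := by
  have := permMat_mul_apply (d := d) τ.symm Mᴴ f h
  rw [← permMat_conjTranspose, ← Matrix.conjTranspose_mul] at this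
  simpa using congrArg star this

lemma permMat_mul (τ : ι ≃ κ) (τ' : κ ≃ ω) :
    permMat d τ' * permMat d τ = permMat d (τ.trans τ') := by
  ext g f
  rw [permMat_mul_apply]
  rfl

lemma permMat_refl : permMat d (Equiv.refl ι) = 1 := by
  ext g f
  simp [permMat, Matrix.one_apply]

lemma permMat_one : permMat d (1 : Equiv.Perm ι) = 1 := permMat_refl

lemma permMat_perm_mul (σ τ : Equiv.Perm ι) :
    permMat d (σ * τ) = permMat d σ * permMat d τ := (permMat_mul τ σ).symm

lemma permMat_symm_mul_self (τ : ι ≃ κ) : permMat d τ.symm * permMat d τ = 1 := by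
  rw [permMat_mul, Equiv.self_trans_symm, permMat_refl]

/-- Operators on a tensor power that commute with all permutations of the factors. -/
def PermInvariant (T : Matrix (ι → Fin d) (ι → Fin d) ℂ) : Prop :=
  ∀ (σ : Equiv.Perm ι) (f g : ι → Fin d), T (f ∘ σ) (g ∘ σ) = T f g

lemma PermInvariant.conjTranspose {T : Matrix (ι → Fin d) (ι → Fin d) ℂ} (h : PermInvariant T) :
    PermInvariant Tᴴ := fun σ f g => by simp [Matrix.conjTranspose_apply, h σ g f]

lemma PermInvariant.mul {S T : Matrix (ι → Fin d) (ι → Fin d) ℂ} (hS : PermInvariant S)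
    (hT : PermInvariant T) : PermInvariant (S * T) := fun σ f g => by
  simp only [Matrix.mul_apply]
  rw [← Equiv.sum_comp (Equiv.arrowCongr σ.symm (Equiv.refl (Fin d)))]
  refine Finset.sum_congr rfl fun h _ => ?_
  have : (Equiv.arrowCongr σ.symm (Equiv.refl (Fin d))) h = h ∘ σ := by
    ext x; simp [Equiv.arrowCongr]
  rw [this, hS, hT]

/-- The tensor product of a family of matrices. -/
def tensorMat (X : ι → Matrix (Fin d) (Fin d) ℂ) : Matrix (ι → Fin d) (ι → Fin d) ℂ :=
  Matrix.of fun f g => ∏ p, X p (f p) (g p)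

lemma tensorMat_mul (X Y : ι → Matrix (Fin d) (Fin d) ℂ) :
    tensorMat X * tensorMat Y = tensorMat fun p => X p * Y p := by
  ext f g
  simp only [tensorMat, Matrix.mul_apply, Matrix.of_apply, ← Finset.prod_mul_distrib]
  rw [Finset.prod_univ_sum, Fintype.piFinset_univ]

lemma tensorMat_conjTranspose (X : ι → Matrix (Fin d) (Fin d) ℂ) :
    (tensorMat X)ᴴ = tensorMat fun p => (X p)ᴴ := by
  ext f g
  simp [tensorMat]

lemma trace_tensorMat (X : ι → Matrix (Fin d) (Fin d) ℂ) :
    (tensorMat X).trace = ∏ p, (X p).trace := by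
  simp only [tensorMat, Matrix.trace, Matrix.diag_apply, Matrix.of_apply]
  rw [Finset.prod_univ_sum, Fintype.piFinset_univ]

lemma tensorMat_diagonal (D : Fin d → ℂ) :
    tensorMat (fun _ : ι => Matrix.diagonal D) = Matrix.diagonal fun f => ∏ p, D (f p) := by
  ext f g
  simp only [tensorMat, Matrix.of_apply, Matrix.diagonal_apply]
  by_cases h : f = g
  · subst h; simp
  · obtain ⟨p, hp⟩ := Function.ne_iff.1 h
    rw [if_neg h]
    exact Finset.prod_eq_zero (Finset.mem_univ p) (by simp [hp])

lemma tensorMat_one : tensorMat (fun _ : ι => (1 : Matrix (Fin d) (Fin d) ℂ)) = 1 := by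
  rw [← Matrix.diagonal_one, tensorMat_diagonal]
  simp

lemma permInvariant_tensorMat (X : Matrix (Fin d) (Fin d) ℂ) :
    PermInvariant (tensorMat fun _ : ι => X) := fun σ f g => by
  simp only [tensorMat, Matrix.of_apply, Function.comp_apply]
  exact Equiv.prod_comp σ fun p => X (f p) (g p)

lemma PermInvariant.permMat_mul {T : Matrix (ι → Fin d) (ι → Fin d) ℂ} (h : PermInvariant T)
    (σ : Equiv.Perm ι) : permMat d σ * T = T * permMat d σ := by
  ext f g
  rw [permMat_mul_apply, mul_permMat_apply, ← h σ f]
  congr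
  ext; simp

/-- The operator `M ⊗ N` on the words labelled by a disjoint union. -/
def sumKron {ι' κ' : Type} (M : Matrix (ι → Fin d) (ι' → Fin d) ℂ)
    (N : Matrix (κ → Fin d) (κ' → Fin d) ℂ) : Matrix (ι ⊕ κ → Fin d) (ι' ⊕ κ' → Fin d) ℂ :=
  Matrix.of fun f g => M (f ∘ Sum.inl) (g ∘ Sum.inl) * N (f ∘ Sum.inr) (g ∘ Sum.inr)

lemma sum_words_sum {M : Type*} [AddCommMonoid M] (F : (ι ⊕ κ → Fin d) → M) :
    ∑ f, F f = ∑ f : ι → Fin d, ∑ g : κ → Fin d, F (Sum.elim f g) := by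
  rw [← Equiv.sum_comp (Equiv.sumArrowEquivProdArrow ι κ (Fin d)).symm, Fintype.sum_prod_type]
  rfl

lemma sumKron_mul {ι₁ κ₁ ι₂ κ₂ : Type} [Fintype ι₁] [DecidableEq ι₁] [Fintype κ₁] [DecidableEq κ₁]
    (M : Matrix (ι → Fin d) (ι₁ → Fin d) ℂ)
    (N : Matrix (κ → Fin d) (κ₁ → Fin d) ℂ) (M' : Matrix (ι₁ → Fin d) (ι₂ → Fin d) ℂ)
    (N' : Matrix (κ₁ → Fin d) (κ₂ → Fin d) ℂ) :
    sumKron M N * sumKron M' N' = sumKron (M * M') (N * N') := by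
  ext f g
  simp only [sumKron, Matrix.mul_apply, Matrix.of_apply, sum_words_sum, Sum.elim_comp_inl,
    Sum.elim_comp_inr, Finset.sum_mul_sum]
  exact Finset.sum_congr rfl fun _ _ => Finset.sum_congr rfl fun _ _ => by ring

lemma sumKron_conjTranspose {ι' κ' : Type} (M : Matrix (ι → Fin d) (ι' → Fin d) ℂ)
    (N : Matrix (κ → Fin d) (κ' → Fin d) ℂ) : (sumKron M N)ᴴ = sumKron Mᴴ Nᴴ := by
  ext f g
  simp [sumKron]

lemma trace_sumKron (M : Matrix (ι → Fin d) (ι → Fin d) ℂ)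
    (N : Matrix (κ → Fin d) (κ → Fin d) ℂ) : (sumKron M N).trace = M.trace * N.trace := by
  simp only [sumKron, Matrix.trace, Matrix.diag_apply, Matrix.of_apply, sum_words_sum,
    Sum.elim_comp_inl, Sum.elim_comp_inr, Finset.sum_mul_sum]

lemma tensorMat_sum (X : ι ⊕ κ → Matrix (Fin d) (Fin d) ℂ) :
    tensorMat X = sumKron (tensorMat fun p => X (Sum.inl p)) (tensorMat fun p => X (Sum.inr p)) := by
  ext f g
  simp [tensorMat, sumKron, Fintype.prod_sum_type]

lemma sumKron_mulVec_apply {ι' κ' : Type} [Fintype ι'] [DecidableEq ι'] [Fintype κ']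
    [DecidableEq κ'] (M : Matrix (ι → Fin d) (ι' → Fin d) ℂ)
    (N : Matrix (κ → Fin d) (κ' → Fin d) ℂ) (x : (ι' ⊕ κ' → Fin d) → ℂ) (f : ι → Fin d)
    (g : κ → Fin d) : (sumKron M N *ᵥ x) (Sum.elim f g) =
      (M *ᵥ fun f' => (N *ᵥ fun g' => x (Sum.elim f' g')) g) f := by
  simp only [sumKron, Matrix.mulVec, dotProduct, Matrix.of_apply, sum_words_sum,
    Sum.elim_comp_inl, Sum.elim_comp_inr, Finset.mul_sum]
  exact Finset.sum_congr rfl fun _ _ => Finset.sum_congr rfl fun _ _ => by ring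

lemma permMat_mul_tensorMat (τ : ι ≃ κ) (X : ι → Matrix (Fin d) (Fin d) ℂ) :
    permMat d τ * tensorMat X = tensorMat (fun p => X (τ.symm p)) * permMat d τ := by
  ext f g
  rw [permMat_mul_apply, mul_permMat_apply]
  simp only [tensorMat, Matrix.of_apply, Function.comp_apply]
  rw [← Equiv.prod_comp τ]
  simp

end Words

/-! ### Matrices of the Young symmetrisers -/

section YoungMatrices

variable {d : ℕ}

/-- The matrix of the row symmetriser. -/
def rowMat (d : ℕ) (μ : YoungDiagram) : Matrix (μ.cells → Fin d) (μ.cells → Fin d) ℂ :=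
  ∑ σ : Equiv.Perm μ.cells with ∀ x, (σ x).1.1 = x.1.1, permMat d σ

/-- The matrix of the column antisymmetriser. -/
def colMat (d : ℕ) (μ : YoungDiagram) : Matrix (μ.cells → Fin d) (μ.cells → Fin d) ℂ :=
  ∑ σ : Equiv.Perm μ.cells with ∀ x, (σ x).1.2 = x.1.2,
    ((Equiv.Perm.sign σ : ℤ) : ℂ) • permMat d σ

/-- The matrix of the Young symmetriser. -/
def youngMat (d : ℕ) (μ : YoungDiagram) : Matrix (μ.cells → Fin d) (μ.cells → Fin d) ℂ :=
  rowMat d μ * colMat d μ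

end YoungMatrices

/-! ### Passage from abstract tensors to word coordinates -/

section Coordinates

variable {d : ℕ} {ι κ : Type} [Fintype ι] [DecidableEq ι] [Fintype κ] [DecidableEq κ]

/-- Coordinates of a tensor in the basis of words. -/
def wordCoords (d : ℕ) (ι : Type) [Fintype ι] [DecidableEq ι] :
    QuditSpace d ι ≃ₗ[ℂ] ((ι → Fin d) → ℂ) :=
  (Basis.piTensorProduct fun _ : ι => Pi.basisFun ℂ (Fin d)).equivFun

lemma wordCoords_tprod (v : ι → Fin d → ℂ) (f : ι → Fin d) :
    wordCoords d ι (PiTensorProduct.tprod ℂ v) f = ∏ p, v p (f p) := by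
  simp [wordCoords, Basis.piTensorProduct_repr_tprod_apply]

lemma wordCoords_reindex (τ : ι ≃ κ) (x : QuditSpace d ι) :
    wordCoords d κ (PiTensorProduct.reindex ℂ (fun _ => Fin d → ℂ) τ x) =
      permMat d τ *ᵥ wordCoords d ι x := by
  induction x using PiTensorProduct.induction_on with
  | smul_tprod r v =>
    ext f
    rw [permMat_mulVec, map_smul, map_smul, map_smul, PiTensorProduct.reindex_tprod]
    simp only [Pi.smul_apply, wordCoords_tprod, Function.comp_apply]
    rw [← Equiv.prod_comp τ]
    simp
  | add x y hx hy => simp only [map_add, hx, hy, Matrix.mulVec_add]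

lemma wordCoords_asAlgebraHom_single (σ : Equiv.Perm ι) (r : ℂ) (x : QuditSpace d ι) :
    wordCoords d ι ((permAction d ι).asAlgebraHom (MonoidAlgebra.single σ r) x) =
      (r • permMat d σ) *ᵥ wordCoords d ι x := by
  rw [Representation.asAlgebraHom_single, LinearMap.smul_apply, map_smul, Matrix.smul_mulVec]
  congr 1
  exact wordCoords_reindex σ x

lemma wordCoords_youngSymmetriser (μ : YoungDiagram) (x : QuditSpace d μ.cells) :
    wordCoords d μ.cells ((permAction d μ.cells).asAlgebraHom (youngSymmetriser μ) x) =
      youngMat d μ *ᵥ wordCoords d μ.cells x := by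
  have hr (x) : wordCoords d μ.cells ((permAction d μ.cells).asAlgebraHom (rowSymmetriser μ) x) =
      rowMat d μ *ᵥ wordCoords d μ.cells x := by
    simp only [rowSymmetriser, rowMat, map_sum, LinearMap.sum_apply,
      wordCoords_asAlgebraHom_single, one_smul, Matrix.sum_mulVec]
  have hc (x) : wordCoords d μ.cells
      ((permAction d μ.cells).asAlgebraHom (columnAntisymmetriser μ) x) =
      colMat d μ *ᵥ wordCoords d μ.cells x := by
    simp only [columnAntisymmetriser, colMat, map_sum, LinearMap.sum_apply,
      wordCoords_asAlgebraHom_single, Matrix.sum_mulVec]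
  rw [youngSymmetriser, map_mul, Module.End.mul_apply, hr, hc, youngMat, Matrix.mulVec_mulVec]

lemma wordCoords_tmulEquiv (x : QuditSpace d ι) (y : QuditSpace d κ) (f : ι ⊕ κ → Fin d) :
    wordCoords d (ι ⊕ κ) (PiTensorProduct.tmulEquiv ℂ (Fin d → ℂ) (x ⊗ₜ y)) f =
      wordCoords d ι x (f ∘ Sum.inl) * wordCoords d κ y (f ∘ Sum.inr) := by
  induction x using PiTensorProduct.induction_on with
  | smul_tprod r v =>
    induction y using PiTensorProduct.induction_on with
    | smul_tprod s w =>
      simp only [← TensorProduct.smul_tmul', TensorProduct.tmul_smul, map_smul,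
        PiTensorProduct.tmulEquiv_apply, Pi.smul_apply, wordCoords_tprod, Fintype.prod_sum_type,
        Sum.elim_inl, Sum.elim_inr, Function.comp_apply, smul_eq_mul]
      ring
    | add x y hx hy => simp only [TensorProduct.tmul_add, map_add, Pi.add_apply, hx, hy, mul_add]
  | add x y hx hy => simp only [TensorProduct.add_tmul, map_add, Pi.add_apply, hx, hy, add_mul]

lemma wordCoords_tmulEquiv_map {F : Matrix (ι → Fin d) (ι → Fin d) ℂ}
    {G : Matrix (κ → Fin d) (κ → Fin d) ℂ} (φ : QuditSpace d ι →ₗ[ℂ] QuditSpace d ι)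
    (ψ : QuditSpace d κ →ₗ[ℂ] QuditSpace d κ)
    (hφ : ∀ x, wordCoords d ι (φ x) = F *ᵥ wordCoords d ι x)
    (hψ : ∀ x, wordCoords d κ (ψ x) = G *ᵥ wordCoords d κ x)
    (z : QuditSpace d ι ⊗[ℂ] QuditSpace d κ) :
    wordCoords d (ι ⊕ κ) (PiTensorProduct.tmulEquiv ℂ (Fin d → ℂ) (TensorProduct.map φ ψ z)) =
      sumKron F G *ᵥ wordCoords d (ι ⊕ κ) (PiTensorProduct.tmulEquiv ℂ (Fin d → ℂ) z) := by
  induction z using TensorProduct.induction_on with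
  | zero => simp
  | tmul x y =>
    ext f
    rw [TensorProduct.map_tmul, wordCoords_tmulEquiv, hφ, hψ, ← Sum.elim_comp_inl_inr f,
      sumKron_mulVec_apply]
    simp only [Sum.elim_comp_inl, Sum.elim_comp_inr, Matrix.mulVec, dotProduct,
      wordCoords_tmulEquiv, Finset.sum_mul, Finset.mul_sum]
    rw [Finset.sum_comm]
    refine Finset.sum_congr rfl fun _ _ => Finset.sum_congr rfl fun _ _ => ?_
    ring
  | add x y hx hy => simp only [map_add, hx, hy, Matrix.mulVec_add]

end Coordinates

/-! ### Vanishing Littlewood–Richardson coefficients as operator identities -/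

section Intertwiner

variable {d : ℕ}

lemma unitaryAction_reindex {ι κ : Type} (τ : ι ≃ κ) (g : Matrix.unitaryGroup (Fin d) ℂ)
    (x : QuditSpace d ι) :
    PiTensorProduct.reindex ℂ (fun _ => Fin d → ℂ) τ (unitaryAction d ι g x) =
      unitaryAction d κ g (PiTensorProduct.reindex ℂ (fun _ => Fin d → ℂ) τ x) :=
  (PiTensorProduct.map_reindex (fun _ => Matrix.toLin' (g : Matrix (Fin d) (Fin d) ℂ)) τ x).symm

lemma unitaryAction_tmulEquiv_symm {ι κ : Type} (g : Matrix.unitaryGroup (Fin d) ℂ)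
    (x : QuditSpace d (ι ⊕ κ)) :
    (PiTensorProduct.tmulEquiv ℂ (Fin d → ℂ)).symm (unitaryAction d (ι ⊕ κ) g x) =
      TensorProduct.map (unitaryAction d ι g) (unitaryAction d κ g)
        ((PiTensorProduct.tmulEquiv ℂ (Fin d → ℂ)).symm x) := by
  induction x using PiTensorProduct.induction_on with
  | smul_tprod r v =>
    simp only [map_smul, unitaryAction, MonoidHom.coe_mk, OneHom.coe_mk,
      PiTensorProduct.map_tprod, PiTensorProduct.tmulEquiv_symm_apply, TensorProduct.map_tmul]
  | add x y hx hy => simp only [map_add, hx, hy]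

/-- The Young symmetriser as a map onto the Weyl module. -/
def toWeylModule (μ : YoungFrame d) :
    QuditSpace d μ.1.cells →ₗ[ℂ] (weylModule μ).toSubmodule :=
  ((permAction d μ.1.cells).asAlgebraHom (youngSymmetriser μ.1)).rangeRestrict

lemma toWeylModule_unitaryAction (μ : YoungFrame d) (g : Matrix.unitaryGroup (Fin d) ℂ)
    (x : QuditSpace d μ.1.cells) : toWeylModule μ (unitaryAction d _ g x) =
      (weylModule μ).toRepresentation g (toWeylModule μ x) :=
  Subtype.ext (permAction_comm d _ _ g x)

/-- The intertwiner `U_λ → U_μ ⊗ U_ν` given by relabelling the factors along `τ`, followed by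
the Young symmetrisers of `μ` and `ν`. -/
def transportIntertwiner {μ ν lam : YoungFrame d} (τ : lam.1.cells ≃ μ.1.cells ⊕ ν.1.cells) :
    Representation.IntertwiningMap (weylModule lam).toRepresentation
      ((weylModule μ).toRepresentation.tprod (weylModule ν).toRepresentation) :=
  LinearMap.intertwiningMap_of_isIntertwiningMap _ _
    (TensorProduct.map (toWeylModule μ) (toWeylModule ν) ∘ₗ
      (PiTensorProduct.tmulEquiv ℂ (Fin d → ℂ)).symm.toLinearMap ∘ₗ
      (PiTensorProduct.reindex ℂ (fun _ => Fin d → ℂ) τ).toLinearMap ∘ₗ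
      (weylModule lam).toSubmodule.subtype) (by
    intro g v
    have h : ((weylModule lam).toRepresentation g v : QuditSpace d lam.1.cells) =
      unitaryAction d _ g v := rfl
    simp only [LinearMap.comp_apply, Submodule.subtype_apply, LinearEquiv.coe_coe, h,
      unitaryAction_reindex, unitaryAction_tmulEquiv_symm, Representation.tprod_apply]
    generalize (PiTensorProduct.tmulEquiv ℂ (Fin d → ℂ)).symm _ = z
    induction z using TensorProduct.induction_on with
    | zero => simp
    | tmul x y => simp only [TensorProduct.map_tmul, toWeylModule_unitaryAction]
    | add x y hx hy => simp only [map_add, hx, hy])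

/-- Multiplication by -1 supplies negatives, so a basis exists even when the space is presented only
as an additive monoid. -/
lemma exists_linearEquiv_pi (V : Type*) [AddCommMonoid V] [Module ℂ V] [Module.Finite ℂ V] :
    ∃ n, Nonempty (V ≃ₗ[ℂ] (Fin n → ℂ)) := by
  let _ : AddCommGroup V := Module.addCommMonoidToAddCommGroup ℂ
  exact ⟨_, ⟨(Module.finBasis ℂ V).equivFun⟩⟩

/-- `finrank` is also 0 in infinite dimension; the embedding into linear maps between coordinate
spaces excludes that case. -/
lemma intertwiningMap_subsingleton_of_finrank_eq_zero {G V W : Type*} [Monoid G] [AddCommMonoid V]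
    [AddCommMonoid W] [Module ℂ V] [Module ℂ W] [Module.Finite ℂ V] [Module.Finite ℂ W]
    (ρ : Representation ℂ G V) (σ : Representation ℂ G W)
    (h : Module.finrank ℂ (Representation.IntertwiningMap ρ σ) = 0) :
    Subsingleton (Representation.IntertwiningMap ρ σ) := by
  obtain ⟨n, ⟨eV⟩⟩ := exists_linearEquiv_pi V
  obtain ⟨m, ⟨eW⟩⟩ := exists_linearEquiv_pi W
  let toLin : Representation.IntertwiningMap ρ σ →ₗ[ℂ] (Fin n → ℂ) →ₗ[ℂ] (Fin m → ℂ) :=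
    { toFun := fun f => eW.toLinearMap ∘ₗ f.toLinearMap ∘ₗ eV.symm.toLinearMap
      map_add' := fun f g => by ext; simp
      map_smul' := fun r f => by ext; simp }
  have hinj : Function.Injective toLin := fun f g hfg => by
    refine Representation.IntertwiningMap.ext (LinearMap.ext fun v => eW.injective ?_)
    simpa [toLin] using LinearMap.congr_fun hfg (eV v)
  have e := LinearEquiv.ofInjective toLin hinj
  rw [e.finrank_eq] at h
  have hbot : LinearMap.range toLin = ⊥ := Submodule.finrank_eq_zero.1 h
  rw [LinearMap.range_eq_bot] at hbot
  exact ⟨fun f g => hinj (by rw [hbot]; rfl)⟩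

/-- If a Littlewood–Richardson coefficient vanishes, so does every composition of Young
symmetrisers that would give an intertwiner. -/
lemma sumKron_youngMat_mul_eq_zero {μ ν lam : YoungFrame d}
    (h : littlewoodRichardson μ ν lam = 0) (τ : lam.1.cells ≃ μ.1.cells ⊕ ν.1.cells) :
    sumKron (youngMat d μ.1) (youngMat d ν.1) * permMat d τ * youngMat d lam.1 = 0 := by
  have hW (κ : YoungFrame d) : Module.Finite ℂ (weylModule κ).toSubmodule := by
    have : Module.Finite ℂ (QuditSpace d κ.1.cells) := inferInstance
    exact Module.Finite.range _
  have hM := hW μ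
  have hN := hW ν
  have hL := hW lam
  have hsub := intertwiningMap_subsingleton_of_finrank_eq_zero
    (V := (weylModule lam).toSubmodule)
    (W := (weylModule μ).toSubmodule ⊗[ℂ] (weylModule ν).toSubmodule)
    (weylModule lam).toRepresentation
    ((weylModule μ).toRepresentation.tprod (weylModule ν).toRepresentation) h
  have hzero : transportIntertwiner τ = 0 := Subsingleton.elim _ _
  refine Matrix.mulVec_injective (funext fun v => ?_)
  obtain ⟨x, rfl⟩ := (wordCoords d lam.1.cells).surjective v
  have hx := congrArg (fun F => F (toWeylModule lam x)) hzero
  have hx' : TensorProduct.map (toWeylModule μ) (toWeylModule ν)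
      ((PiTensorProduct.tmulEquiv ℂ (Fin d → ℂ)).symm
      (PiTensorProduct.reindex ℂ (fun _ => Fin d → ℂ) τ
        ((permAction d lam.1.cells).asAlgebraHom (youngSymmetriser lam.1) x))) = 0 := hx
  -- Including both Weyl modules in their tensor powers turns the vanishing intertwiner into a
  -- statement about plain symmetrisers, which word coordinates can express.
  have hmap : ∀ z, TensorProduct.map (weylModule μ).toSubmodule.subtype
      (weylModule ν).toSubmodule.subtype
      (TensorProduct.map (toWeylModule μ) (toWeylModule ν) z) =
      TensorProduct.map ((permAction d μ.1.cells).asAlgebraHom (youngSymmetriser μ.1))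
        ((permAction d ν.1.cells).asAlgebraHom (youngSymmetriser ν.1)) z := fun z => by
    rw [← LinearMap.comp_apply, ← TensorProduct.map_comp]
    rfl
  have h1 := congrArg (TensorProduct.map (weylModule μ).toSubmodule.subtype
      (weylModule ν).toSubmodule.subtype) hx'
  rw [hmap, map_zero] at h1
  have h2 := wordCoords_tmulEquiv_map _ _ (wordCoords_youngSymmetriser (d := d) μ.1)
    (wordCoords_youngSymmetriser (d := d) ν.1) ((PiTensorProduct.tmulEquiv ℂ (Fin d → ℂ)).symm
      (PiTensorProduct.reindex ℂ (fun _ => Fin d → ℂ) τ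
        ((permAction d lam.1.cells).asAlgebraHom (youngSymmetriser lam.1) x)))
  rw [h1, map_zero, map_zero, LinearEquiv.apply_symm_apply, wordCoords_reindex,
    wordCoords_youngSymmetriser] at h2
  rw [Matrix.zero_mulVec, h2, Matrix.mulVec_mulVec, Matrix.mulVec_mulVec, Matrix.mul_assoc]

end Intertwiner

/-! ### Signed sums over subgroups of permutations -/

section CharacterSums

variable {d : ℕ} {ι : Type} [Fintype ι] [DecidableEq ι]

/-- The sum of the permutations satisfying `P`, weighted by a sign character. -/
def charMat (d : ℕ) (P : Equiv.Perm ι → Prop) [DecidablePred P] (ε : Equiv.Perm ι →* ℤˣ) :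
    Matrix (ι → Fin d) (ι → Fin d) ℂ :=
  ∑ σ : Equiv.Perm ι with P σ, ((ε σ : ℤ) : ℂ) • permMat d σ

variable {P : Equiv.Perm ι → Prop} [DecidablePred P] {ε : Equiv.Perm ι →* ℤˣ}

lemma units_cast_mul_self (u : ℤˣ) : ((u : ℤ) : ℂ) * ((u : ℤ) : ℂ) = 1 := by
  rw [← Int.cast_mul, ← Units.val_mul, Int.units_mul_self]; simp

lemma charMat_conjTranspose (hinv : ∀ σ, P σ → P σ⁻¹) : (charMat d P ε)ᴴ = charMat d P ε := by
  rw [charMat, Matrix.conjTranspose_sum]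
  refine Finset.sum_bij' (fun σ _ => σ⁻¹) (fun σ _ => σ⁻¹) ?_ ?_ ?_ ?_ ?_
  · intro σ hσ; simpa using hinv σ (by simpa using hσ)
  · intro σ hσ; simpa using hinv σ (by simpa using hσ)
  · simp
  · simp
  · intro σ _
    rw [Matrix.conjTranspose_smul, permMat_conjTranspose, map_inv, Int.units_inv_eq_self]
    simp
    rfl

lemma permMat_mul_charMat (hmul : ∀ σ τ, P σ → P τ → P (σ * τ)) (hinv : ∀ σ, P σ → P σ⁻¹)
    {τ : Equiv.Perm ι} (hτ : P τ) :
    permMat d τ * charMat d P ε = ((ε τ : ℤ) : ℂ) • charMat d P ε := by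
  rw [charMat, Finset.mul_sum, Finset.smul_sum]
  refine Finset.sum_bij' (fun σ _ => τ * σ) (fun σ _ => τ⁻¹ * σ) ?_ ?_ ?_ ?_ ?_
  · intro σ hσ; simpa using hmul τ σ hτ (by simpa using hσ)
  · intro σ hσ; simpa using hmul τ⁻¹ σ (hinv τ hτ) (by simpa using hσ)
  · simp
  · simp
  · intro σ _
    rw [map_mul, Units.val_mul, Int.cast_mul, smul_smul, ← mul_assoc, units_cast_mul_self,
      one_mul, permMat_perm_mul, Matrix.mul_smul]

lemma charMat_mul_permMat (hmul : ∀ σ τ, P σ → P τ → P (σ * τ)) (hinv : ∀ σ, P σ → P σ⁻¹)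
    {τ : Equiv.Perm ι} (hτ : P τ) :
    charMat d P ε * permMat d τ = ((ε τ : ℤ) : ℂ) • charMat d P ε := by
  have h := congrArg Matrix.conjTranspose
    (permMat_mul_charMat (d := d) (ε := ε) hmul hinv (hinv τ hτ))
  rw [Matrix.conjTranspose_mul, Matrix.conjTranspose_smul, charMat_conjTranspose hinv,
    permMat_conjTranspose, map_inv, Int.units_inv_eq_self] at h
  have hsymm : Equiv.symm τ⁻¹ = τ := inv_inv τ
  simpa [hsymm] using h

lemma charMat_mul_self (hmul : ∀ σ τ, P σ → P τ → P (σ * τ)) (hinv : ∀ σ, P σ → P σ⁻¹) :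
    charMat d P ε * charMat d P ε =
      ((Finset.univ.filter P).card : ℂ) • charMat d P ε := by
  conv_lhs => enter [1]; rw [charMat]
  rw [Finset.sum_mul, Finset.sum_congr rfl
    (g := fun _ => charMat d P ε)]
  · rw [Finset.sum_const, ← Nat.cast_smul_eq_nsmul ℂ]
  · intro σ hσ
    rw [Matrix.smul_mul, permMat_mul_charMat hmul hinv (by simpa using hσ), smul_smul,
      units_cast_mul_self, one_smul]

lemma PermInvariant.mul_charMat {T : Matrix (ι → Fin d) (ι → Fin d) ℂ} (h : PermInvariant T) :
    T * charMat d P ε = charMat d P ε * T := by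
  simp only [charMat, Finset.mul_sum, Finset.sum_mul, Matrix.mul_smul, Matrix.smul_mul,
    h.permMat_mul]

end CharacterSums

/-! ### Algebra of row and column symmetrisers -/

section YoungMatrices

variable {d : ℕ} (μ : YoungDiagram)

lemma rowMat_eq_charMat :
    rowMat d μ = charMat d (fun σ : Equiv.Perm μ.cells => ∀ x, (σ x).1.1 = x.1.1) 1 := by
  simp [rowMat, charMat]

lemma colMat_eq_charMat :
    colMat d μ = charMat d (fun σ : Equiv.Perm μ.cells => ∀ x, (σ x).1.2 = x.1.2)
      Equiv.Perm.sign := rfl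

lemma rows_mul (σ τ : Equiv.Perm μ.cells) (hσ : ∀ x, (σ x).1.1 = x.1.1)
    (hτ : ∀ x, (τ x).1.1 = x.1.1) : ∀ x, ((σ * τ) x).1.1 = x.1.1 := fun x => by
  rw [Equiv.Perm.mul_apply, hσ, hτ]

lemma cols_mul (σ τ : Equiv.Perm μ.cells) (hσ : ∀ x, (σ x).1.2 = x.1.2)
    (hτ : ∀ x, (τ x).1.2 = x.1.2) : ∀ x, ((σ * τ) x).1.2 = x.1.2 := fun x => by
  rw [Equiv.Perm.mul_apply, hσ, hτ]

lemma rows_inv (σ : Equiv.Perm μ.cells) (hσ : ∀ x, (σ x).1.1 = x.1.1) :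
    ∀ x, (σ⁻¹ x).1.1 = x.1.1 := fun x => by
  rw [← hσ (σ⁻¹ x)]
  simp

lemma cols_inv (σ : Equiv.Perm μ.cells) (hσ : ∀ x, (σ x).1.2 = x.1.2) :
    ∀ x, (σ⁻¹ x).1.2 = x.1.2 := fun x => by
  rw [← hσ (σ⁻¹ x)]
  simp

lemma rowMat_conjTranspose : (rowMat d μ)ᴴ = rowMat d μ := by
  rw [rowMat_eq_charMat, charMat_conjTranspose (rows_inv μ)]

lemma colMat_conjTranspose : (colMat d μ)ᴴ = colMat d μ := by
  rw [colMat_eq_charMat, charMat_conjTranspose (cols_inv μ)]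

lemma youngMat_conjTranspose : (youngMat d μ)ᴴ = colMat d μ * rowMat d μ := by
  rw [youngMat, Matrix.conjTranspose_mul, rowMat_conjTranspose, colMat_conjTranspose]

/-- The order of the row group. -/
def rowOrder : ℕ :=
  (Finset.univ.filter fun σ : Equiv.Perm μ.cells => ∀ x, (σ x).1.1 = x.1.1).card

lemma rowOrder_ne_zero : (rowOrder μ : ℂ) ≠ 0 := by
  rw [Nat.cast_ne_zero, rowOrder, Finset.card_ne_zero]
  exact ⟨1, by simp⟩

lemma rowMat_mul_self : rowMat d μ * rowMat d μ = (rowOrder μ : ℂ) • rowMat d μ := by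
  rw [rowMat_eq_charMat, charMat_mul_self (rows_mul μ) (rows_inv μ), rowOrder]

lemma PermInvariant.mul_youngMat {μ : YoungDiagram}
    {T : Matrix (μ.cells → Fin d) (μ.cells → Fin d) ℂ} (h : PermInvariant T) :
    T * youngMat d μ = youngMat d μ * T := by
  rw [youngMat, rowMat_eq_charMat, colMat_eq_charMat, ← mul_assoc, h.mul_charMat, mul_assoc,
    h.mul_charMat, mul_assoc]

lemma PermInvariant.mul_youngMat_conjTranspose {μ : YoungDiagram}
    {T : Matrix (μ.cells → Fin d) (μ.cells → Fin d) ℂ} (h : PermInvariant T) :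
    T * (youngMat d μ)ᴴ = (youngMat d μ)ᴴ * T := by
  have := congrArg Matrix.conjTranspose h.conjTranspose.mul_youngMat
  simpa [Matrix.conjTranspose_mul] using this.symm

/-- If `c r` kills all column permutations of a vector, then `r c` kills it. -/
lemma youngMat_mulVec_eq_zero {z : (μ.cells → Fin d) → ℂ}
    (h : ∀ σ : Equiv.Perm μ.cells, (youngMat d μ)ᴴ *ᵥ (permMat d σ *ᵥ z) = 0) :
    youngMat d μ *ᵥ z = 0 := by
  have h1 : (colMat d μ * rowMat d μ) *ᵥ (colMat d μ *ᵥ z) = 0 := by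
    rw [← youngMat_conjTranspose]
    conv_lhs => rw [colMat]
    simp only [Matrix.sum_mulVec, Matrix.smul_mulVec, Matrix.mulVec_sum, Matrix.mulVec_smul, h,
      smul_zero, Finset.sum_const_zero]
  -- The Gram operator of r c is c r² c, a multiple of c r c. It kills `z` by `h1`, and a vector
  -- killed by the Gram operator is killed by r c.
  have h2 : (youngMat d μ)ᴴ * youngMat d μ =
      (rowOrder μ : ℂ) • (colMat d μ * rowMat d μ * colMat d μ) := by
    rw [youngMat_conjTranspose, youngMat, Matrix.mul_assoc, ← Matrix.mul_assoc (rowMat d μ),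
      rowMat_mul_self, Matrix.smul_mul, Matrix.mul_smul, Matrix.mul_assoc]
  rw [← Matrix.conjTranspose_mul_self_mulVec_eq_zero, h2, Matrix.smul_mulVec,
    ← Matrix.mulVec_mulVec, h1, smul_zero]

end YoungMatrices

/-! ### Highest weight vectors and the Specht vector -/

section HighestWeight

variable {d : ℕ} {ι κ : Type} [Fintype ι] [DecidableEq ι] [Fintype κ] [DecidableEq κ]

/-- The number of occurrences of each letter in a word. -/
def content (f : ι → Fin d) (i : Fin d) : ℕ := (Finset.univ.filter fun p => f p = i).card

lemma content_comp (f : κ → Fin d) (σ : ι ≃ κ) : content (f ∘ σ) = content f := by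
  ext i
  simp only [content, Function.comp_apply, ← Fintype.card_subtype]
  exact Fintype.card_congr (σ.subtypeEquiv fun _ => Iff.rfl)

lemma sum_content (f : ι → Fin d) : ∑ i, content f i = Fintype.card ι := by
  simpa [content] using (Finset.card_eq_sum_card_fiberwise (s := Finset.univ) (t := Finset.univ)
    (f := f) (by simp)).symm

lemma prod_word {M : Type*} [CommMonoid M] (f : ι → Fin d) (r : Fin d → M) :
    ∏ p, r (f p) = ∏ i, r i ^ content f i := by
  simp only [content]
  rw [← Finset.prod_fiberwise' Finset.univ f r]
  simp

/-- Upper triangular matrices with ones on the diagonal. -/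
structure IsUpperUnipotent (U : Matrix (Fin d) (Fin d) ℂ) : Prop where
  diag : ∀ i, U i i = 1
  lower : ∀ i j, j < i → U i j = 0

/-- Highest weight vectors of weight `lam`: weight vectors fixed by the upper unipotent
matrices. -/
structure IsHighestWeight (lam : Fin d → ℕ) (y : (ι → Fin d) → ℂ) : Prop where
  weight : ∀ f, y f ≠ 0 → content f = lam
  fixed : ∀ U, IsUpperUnipotent U → tensorMat (fun _ => U) *ᵥ y = y

lemma IsHighestWeight.transport {lam : Fin d → ℕ} {y : (ι → Fin d) → ℂ}
    (h : IsHighestWeight lam y) (τ : ι ≃ κ) : IsHighestWeight lam (permMat d τ *ᵥ y) where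
  weight f hf := by
    rw [permMat_mulVec] at hf
    rw [← h.weight _ hf, content_comp]
  fixed U hU := by
    rw [Matrix.mulVec_mulVec, ← permMat_mul_tensorMat τ fun _ => U, ← Matrix.mulVec_mulVec,
      h.fixed U hU]

/-- The word labelling each box by its row. -/
def rowWord (μ : YoungFrame d) (x : μ.1.cells) : Fin d :=
  ⟨x.1.1, by
    have h : (x.1.1, x.1.2) ∈ μ.1 := x.2
    have h0 : (x.1.1, 0) ∈ μ.1 := μ.1.up_left_mem le_rfl (Nat.zero_le _) h
    exact (YoungDiagram.mem_iff_lt_colLen.1 h0).trans_le μ.2⟩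

lemma content_rowWord (μ : YoungFrame d) (i : Fin d) :
    content (rowWord μ) i = μ.1.rowLen i := by
  rw [YoungDiagram.rowLen_eq_card, content, YoungDiagram.row, ← Fintype.card_subtype,
    ← Fintype.card_coe]
  refine Fintype.card_congr ⟨fun x => ⟨x.1.1, ?_⟩, fun x => ⟨⟨x.1, ?_⟩, ?_⟩, ?_, ?_⟩
  · have := x.2
    rw [rowWord, Fin.ext_iff] at this
    exact Finset.mem_filter.2 ⟨x.1.2, this⟩
  · exact (Finset.mem_filter.1 x.2).1
  · exact Fin.ext (Finset.mem_filter.1 x.2).2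
  · intro x; rfl
  · intro x; rfl

/-- Row permutations fix the row word, so r multiplies this coordinate by the order of the row
group. Nonvanishing of a Young symmetriser thereby reduces to that of one scalar. -/
lemma youngMat_mulVec_rowWord (μ : YoungFrame d) (z : (μ.1.cells → Fin d) → ℂ) :
    (youngMat d μ.1 *ᵥ z) (rowWord μ) = rowOrder μ.1 * (colMat d μ.1 *ᵥ z) (rowWord μ) := by
  rw [youngMat, ← Matrix.mulVec_mulVec]
  generalize colMat d μ.1 *ᵥ z = v
  rw [rowMat, Matrix.sum_mulVec, Finset.sum_apply, Finset.sum_congr rfl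
    (g := fun _ => v (rowWord μ))]
  · simp [rowOrder]
  · intro σ hσ
    rw [permMat_mulVec]
    congr 1
    ext x
    exact (Finset.mem_filter.1 hσ).2 x

lemma rowMat_mulVec_rowWord (μ : YoungFrame d) :
    rowMat d μ.1 *ᵥ Pi.single (rowWord μ) 1 = (rowOrder μ.1 : ℂ) • Pi.single (rowWord μ) 1 := by
  rw [rowMat, Matrix.sum_mulVec, Finset.sum_congr rfl
    (g := fun _ => Pi.single (rowWord μ) (1 : ℂ))]
  · rw [Finset.sum_const, ← Nat.cast_smul_eq_nsmul ℂ]; rfl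
  · intro σ hσ
    have hw : rowWord μ ∘ σ = rowWord μ := by
      ext x
      exact (Finset.mem_filter.1 hσ).2 x
    ext f
    rw [permMat_mulVec, Pi.single_apply, Pi.single_apply]
    have : f ∘ σ = rowWord μ ↔ f = rowWord μ :=
      ⟨fun h => by
        have h' : (f ∘ σ) ∘ σ.symm = (rowWord μ ∘ σ) ∘ σ.symm := by rw [h, hw]
        simpa [Function.comp_assoc] using h', fun h => by rw [h, hw]⟩
    simp only [this]

/-- The antisymmetrised row word, a highest weight vector. -/
def specht (μ : YoungFrame d) : (μ.1.cells → Fin d) → ℂ :=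
  colMat d μ.1 *ᵥ Pi.single (rowWord μ) 1

/-- A column permutation fixing the row word preserves rows as well as columns, hence is the
identity; only one term survives. -/
lemma specht_rowWord (μ : YoungFrame d) : specht μ (rowWord μ) = 1 := by
  rw [specht, colMat, Matrix.sum_mulVec, Finset.sum_apply, Finset.sum_eq_single 1]
  · simp [permMat_one]
  · intro σ hσ hne
    rw [Matrix.smul_mulVec, Pi.smul_apply, permMat_mulVec, Pi.single_eq_of_ne, smul_zero]
    intro h
    refine hne (Equiv.ext fun x => Subtype.ext (Prod.ext ?_ ?_))
    · exact congrArg Fin.val (congrFun h x)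
    · exact (Finset.mem_filter.1 hσ).2 x
  · intro h
    exact absurd (Finset.mem_filter.2 ⟨Finset.mem_univ _, by simp⟩) h

/-- The column antisymmetriser kills words with a repetition in a column. -/
lemma colMat_mulVec_single_eq_zero (μ : YoungDiagram) (g : μ.cells → Fin d) {p q : μ.cells}
    (hpq : p ≠ q) (hcol : p.1.2 = q.1.2) (hg : g p = g q) :
    colMat d μ *ᵥ Pi.single g 1 = 0 := by
  have hs : ∀ x, (Equiv.swap p q x).1.2 = x.1.2 := fun x => by
    rcases eq_or_ne x p with rfl | h1
    · simp [hcol]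
    rcases eq_or_ne x q with rfl | h2
    · simp [hcol]
    rw [Equiv.swap_apply_of_ne_of_ne h1 h2]
  have hc := charMat_mul_permMat (d := d) (ε := Equiv.Perm.sign) (cols_mul μ) (cols_inv μ) hs
  rw [← colMat_eq_charMat, Equiv.Perm.sign_swap hpq] at hc
  have hgs : g ∘ Equiv.swap p q = g := by
    ext x
    rcases eq_or_ne x p with rfl | h1
    · simp [hg]
    rcases eq_or_ne x q with rfl | h2
    · simp [hg]
    simp [Equiv.swap_apply_of_ne_of_ne h1 h2]
  have hfix : permMat d (Equiv.swap p q) *ᵥ Pi.single g 1 = Pi.single g (1 : ℂ) := by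
    ext f
    rw [permMat_mulVec, Pi.single_apply, Pi.single_apply]
    have : f ∘ Equiv.swap p q = g ↔ f = g :=
      ⟨fun h => by
        have h' : (f ∘ Equiv.swap p q) ∘ Equiv.swap p q = g ∘ Equiv.swap p q := by rw [h]
        rw [hgs] at h'
        rw [← h']
        ext x
        simp, fun h => by rw [h, hgs]⟩
    simp only [this]
  have h := congrArg (fun M => M *ᵥ Pi.single g (1 : ℂ)) hc
  simp only [← Matrix.mulVec_mulVec, hfix, Matrix.smul_mulVec] at h
  have h2 : (2 : ℂ) • (colMat d μ *ᵥ Pi.single g (1 : ℂ)) = 0 := by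
    rw [two_smul]
    nth_rewrite 1 [h]
    simp
  exact (smul_eq_zero.1 h2).resolve_left two_ne_zero

/-- A word bounded by the row word and injective on columns is the row word. -/
lemma eq_rowWord (μ : YoungFrame d) (g : μ.1.cells → Fin d) (hle : ∀ x, g x ≤ rowWord μ x)
    (hinj : ∀ p q : μ.1.cells, p ≠ q → p.1.2 = q.1.2 → g p ≠ g q) : g = rowWord μ := by
  have key : ∀ (i j : ℕ) (h : (i, j) ∈ μ.1.cells), (g ⟨(i, j), h⟩ : ℕ) = i := by
    intro i
    induction i using Nat.strong_induction_on with
    | _ i ih =>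
      intro j h
      by_contra hne
      have hlt : (g ⟨(i, j), h⟩ : ℕ) < i :=
        lt_of_le_of_ne (hle ⟨(i, j), h⟩) hne
      -- A letter smaller than `i` names a higher row; by induction the box of that row in the same
      -- column already carries this letter.
      have hmem : ((g ⟨(i, j), h⟩ : ℕ), j) ∈ μ.1.cells := μ.1.up_left_mem hlt.le le_rfl h
      refine hinj ⟨_, hmem⟩ ⟨(i, j), h⟩ ?_ rfl (Fin.ext (ih _ hlt j hmem))
      intro he
      exact hlt.ne (congrArg (fun x => x.1.1) he)
  ext x
  exact key x.1.1 x.1.2 x.2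

/-- A tensor power of an upper unipotent matrix commutes with c and sends the row word to itself
plus words bounded by it letter by letter. By `eq_rowWord` each of the others repeats a letter in
some column, so c kills it. -/
lemma isHighestWeight_specht (μ : YoungFrame d) :
    IsHighestWeight (fun i => μ.1.rowLen i) (specht μ) where
  weight f hf := by
    have hex : ∃ σ : Equiv.Perm μ.1.cells, f ∘ σ = rowWord μ := by
      by_contra hno
      push Not at hno
      apply hf
      rw [specht, colMat, Matrix.sum_mulVec, Finset.sum_apply]
      refine Finset.sum_eq_zero fun σ _ => ?_
      rw [Matrix.smul_mulVec, Pi.smul_apply, permMat_mulVec, Pi.single_eq_of_ne (hno σ), smul_zero]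
    obtain ⟨σ, hσ⟩ := hex
    ext i
    rw [← content_rowWord, ← hσ, content_comp]
  fixed U hU := by
    rw [specht, Matrix.mulVec_mulVec, colMat_eq_charMat,
      (permInvariant_tensorMat U).mul_charMat, ← colMat_eq_charMat, ← Matrix.mulVec_mulVec]
    have hexp : tensorMat (fun _ : μ.1.cells => U) *ᵥ Pi.single (rowWord μ) 1 =
        ∑ g, (∏ p, U (g p) (rowWord μ p)) • Pi.single g (1 : ℂ) := by
      ext f
      simp [tensorMat, Finset.sum_apply, Pi.single_apply]
    rw [hexp, Matrix.mulVec_sum, Finset.sum_eq_single (rowWord μ)]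
    · simp [hU.diag]
    · intro g _ hg
      rw [Matrix.mulVec_smul]
      by_cases hle : ∀ x, g x ≤ rowWord μ x
      · have : ∃ p q : μ.1.cells, p ≠ q ∧ p.1.2 = q.1.2 ∧ g p = g q := by
          by_contra hno
          push Not at hno
          exact hg (eq_rowWord μ g hle hno)
        obtain ⟨p, q, hpq, hcol, hgpq⟩ := this
        rw [colMat_mulVec_single_eq_zero μ.1 g hpq hcol hgpq, smul_zero]
      · push Not at hle
        obtain ⟨x, hx⟩ := hle
        rw [Finset.prod_eq_zero (Finset.mem_univ x) (hU.lower _ _ hx), zero_smul]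
    · simp

end HighestWeight

/-! ### Gauss elimination as a uniqueness principle -/

section Elimination

variable {d : ℕ}

/-- A continuous function that is invariant under row and column operations of Gauss elimination
without pivoting, and vanishes on diagonal matrices, is zero. -/
lemma eq_zero_of_elimination {F : Matrix (Fin d) (Fin d) ℂ → ℂ} (hF : Continuous F)
    (hU : ∀ X U, IsUpperUnipotent U → F (X * U) = F X)
    (hL : ∀ X L, IsUpperUnipotent Lᴴ → F (L * X) = F X)
    (hD : ∀ D, F (Matrix.diagonal D) = 0) (X : Matrix (Fin d) (Fin d) ℂ) : F X = 0 := by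
  -- Here `j` counts the leading rows and columns already cleared off the diagonal, and `n` those
  -- left.
  have key : ∀ n j : ℕ, j + n = d → ∀ X : Matrix (Fin d) (Fin d) ℂ,
      (∀ a b : Fin d, a ≠ b → ((a : ℕ) < j ∨ (b : ℕ) < j) → X a b = 0) → F X = 0 := by
    intro n
    induction n with
    | zero =>
      intro j hj X hX
      have : X = Matrix.diagonal fun i => X i i := by
        ext a b
        rw [Matrix.diagonal_apply]
        split_ifs with h
        · rw [h]
        · exact hX a b h (Or.inl (by omega))
      rw [this, hD]
    | succ n ih =>
      intro j hj
      obtain ⟨k, rfl⟩ : ∃ k : Fin d, (k : ℕ) = j := ⟨⟨j, by omega⟩, rfl⟩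
      have pivot : ∀ X : Matrix (Fin d) (Fin d) ℂ, X k k ≠ 0 →
          (∀ a b : Fin d, a ≠ b → ((a : ℕ) < k ∨ (b : ℕ) < k) → X a b = 0) → F X = 0 := by
        intro X hk hX
        -- The factors `1 + u eₖᵀ` on the left and `1 + eₖ vᵀ` on the right clear column and row
        -- `k`.
        set u : Fin d → ℂ := fun a => if k < a then -X a k / X k k else 0 with hu
        set v : Fin d → ℂ := fun b => if k < b then -X k b / X k k else 0 with hv
        have hLow : IsUpperUnipotent (1 + Matrix.vecMulVec u (Pi.single k 1))ᴴ := by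
          constructor
          · intro i
            simp only [Matrix.conjTranspose_apply, Matrix.add_apply, Matrix.one_apply_eq,
              Matrix.vecMulVec_apply, Pi.single_apply, hu]
            split_ifs with h1 h2 <;> first | (subst h2; exact absurd h1 (lt_irrefl _)) | simp
          · intro a b hab
            simp only [Matrix.conjTranspose_apply, Matrix.add_apply, Matrix.one_apply_ne hab.ne,
              Matrix.vecMulVec_apply, Pi.single_apply, hu]
            split_ifs with h1 h2 <;> first | (subst h2; exact absurd hab h1.not_gt) | simp
        have hUpp : IsUpperUnipotent (1 + Matrix.vecMulVec (Pi.single k 1) v) := by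
          constructor
          · intro i
            simp only [Matrix.add_apply, Matrix.one_apply_eq, Matrix.vecMulVec_apply,
              Pi.single_apply, hv]
            split_ifs with h1 h2 <;> first | (subst h1; exact absurd h2 (lt_irrefl _)) | simp
          · intro a b hab
            simp only [Matrix.add_apply, Matrix.one_apply_ne hab.ne',
              Matrix.vecMulVec_apply, Pi.single_apply, hv]
            split_ifs with h1 h2 <;> first | (subst h1; exact absurd hab h2.not_gt) | simp
        rw [← hL X _ hLow, ← hU _ _ hUpp]
        have hY : ∀ a b, ((1 + Matrix.vecMulVec u (Pi.single k 1)) * X) a b =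
            X a b + u a * X k b := by
          intro a b
          rw [add_mul, one_mul, Matrix.add_apply, Matrix.vecMulVec_mul, Matrix.vecMulVec_apply]
          simp
        have hZ : ∀ (Y : Matrix (Fin d) (Fin d) ℂ) a b,
            (Y * (1 + Matrix.vecMulVec (Pi.single k 1) v)) a b = Y a b + Y a k * v b := by
          intro Y a b
          rw [mul_add, mul_one, Matrix.add_apply, Matrix.mul_vecMulVec, Matrix.vecMulVec_apply]
          simp
        apply ih (k + 1) (by omega)
        intro a b hab h
        rw [hZ, hY, hY]
        rcases lt_trichotomy a k with ha | rfl | ha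
        · simp [hu, ha.not_gt, hX a b hab (Or.inl ha), hX a k ha.ne (Or.inl ha)]
        · rcases lt_or_gt_of_ne hab with hb | hb
          · simp only [hu, hv, lt_irrefl, if_false, hb, if_true]
            field_simp
            ring
          · simp [hu, hv, hb.not_gt, hX a b hab (Or.inr hb)]
        · have hb : (b : ℕ) < k ∨ b = k := by
            have hka : (k : ℕ) < a := ha
            rcases Nat.lt_or_ge b k with h' | h'
            · exact Or.inl h'
            · exact Or.inr (Fin.ext (by omega))
          rcases hb with hb | rfl
          · have hb' : b < k := hb
            simp [hv, hb'.not_gt, hX a b hab (Or.inr hb), hX k b hb'.ne' (Or.inr hb)]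
          · simp only [hu, hv, lt_irrefl, if_false, ha, if_true]
            field_simp
            ring
      intro X hX
      by_cases hk : X k k = 0
      -- A matrix with zero pivot is the limit of `X + t Eₖₖ` with t ≠ 0, whose pivot is `t`;
      -- continuity of `F` does the rest.
      · have hcont : Continuous fun t : ℂ => F (X + t • Matrix.single k k 1) := by fun_prop
        have heq := hcont.ext_on (dense_compl_singleton (0 : ℂ)) 
          (continuous_const : Continuous fun _ : ℂ => (0 : ℂ)) (by
          intro t ht
          refine pivot _ ?_ ?_
          · simpa [hk] using ht
          · intro a b hab h
            have : ¬ (k = a ∧ k = b) := fun ⟨h1, h2⟩ => hab (h1.symm.trans h2)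
            simp [hX a b hab h, this])
        simpa using congrFun heq 0
      · exact pivot X hk hX
  exact key d 0 (by simp) X (by simp)

end Elimination

/-! ### Joint types of words and permutation invariant operators -/

section Types

variable {d : ℕ} {ι : Type} [Fintype ι] [DecidableEq ι]

lemma exists_perm_of_card_fiber_eq {α : Type*} [DecidableEq α] (h h' : ι → α)
    (hc : ∀ a, (Finset.univ.filter fun p => h p = a).card =
      (Finset.univ.filter fun p => h' p = a).card) : ∃ σ : Equiv.Perm ι, h' ∘ σ = h := by
  have e : ∀ a, Nonempty ({p // h p = a} ≃ {p // h' p = a}) := fun a => by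
    rw [← Fintype.card_eq, Fintype.card_subtype, Fintype.card_subtype, hc]
  exact ⟨Equiv.ofFiberEquiv fun a => (e a).some, funext fun p => Equiv.ofFiberEquiv_map _ p⟩

/-- Permutation invariant operators depend only on the joint type of two words. -/
lemma PermInvariant.eq_of_card_eq {T : Matrix (ι → Fin d) (ι → Fin d) ℂ} (hT : PermInvariant T)
    {f g f' g' : ι → Fin d} (hc : ∀ a, (Finset.univ.filter fun p => (f p, g p) = a).card =
      (Finset.univ.filter fun p => (f' p, g' p) = a).card) : T f g = T f' g' := by
  obtain ⟨σ, hσ⟩ := exists_perm_of_card_fiber_eq (fun p => (f p, g p)) (fun p => (f' p, g' p)) hc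
  have hf : f' ∘ σ = f := funext fun p => congrArg Prod.fst (congrFun hσ p)
  have hg : g' ∘ σ = g := funext fun p => congrArg Prod.snd (congrFun hσ p)
  rw [← hf, ← hg, hT]

/-- The tensor powers span the permutation invariant operators, in dual form. -/
lemma sum_mul_permInvariant_eq_zero {A : (ι → Fin d) → (ι → Fin d) → ℂ}
    (h : ∀ X : Matrix (Fin d) (Fin d) ℂ, ∑ f, ∑ g, A f g * tensorMat (fun _ => X) f g = 0)
    {T : Matrix (ι → Fin d) (ι → Fin d) ℂ} (hT : PermInvariant T) :
    ∑ f, ∑ g, A f g * T f g = 0 := by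
  set cnt : (ι → Fin d) × (ι → Fin d) → (Fin d × Fin d →₀ ℕ) :=
    fun fg => ∑ p, Finsupp.single (fg.1 p, fg.2 p) 1 with hcnt
  have hfac : Function.FactorsThrough
      (fun fg : (ι → Fin d) × (ι → Fin d) => T fg.1 fg.2) cnt := by
    intro x y hxy
    refine hT.eq_of_card_eq fun a => ?_
    have := DFunLike.congr_fun hxy a
    simpa [hcnt, Finsupp.finsetSum_apply, Finsupp.single_apply, Finset.sum_boole] using this
  have hmon : ∀ f g : ι → Fin d, (∏ p, MvPolynomial.X (f p, g p) : MvPolynomial (Fin d × Fin d) ℂ)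
      = MvPolynomial.monomial (cnt (f, g)) 1 := by
    intro f g
    simp only [hcnt, MvPolynomial.X]
    exact (MvPolynomial.monomial_sum_one _ _).symm
  -- The hypothesis says that this polynomial in the entries of `X` vanishes everywhere, so it is
  -- zero as a polynomial.
  have hpoly : (∑ f : ι → Fin d, ∑ g : ι → Fin d, A f g •
      (∏ p, MvPolynomial.X (f p, g p) : MvPolynomial (Fin d × Fin d) ℂ)) = 0 := by
    refine MvPolynomial.funext fun x => ?_
    have := h (Matrix.of fun i j => x (i, j))
    simpa [tensorMat, MvPolynomial.smul_eval, map_sum, map_prod] using this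
  -- The exponent of each monomial is a joint type, on which alone `T` depends. The linear
  -- functional sending each such monomial to the corresponding value of `T` is therefore well
  -- defined.
  have := congrArg ((MvPolynomial.basisMonomials (Fin d × Fin d) ℂ).constr ℂ
    (Function.extend cnt (fun fg => T fg.1 fg.2) 0)) hpoly
  simp only [map_sum, map_smul, map_zero, hmon] at this
  rw [← this]
  refine Finset.sum_congr rfl fun f _ => Finset.sum_congr rfl fun g _ => ?_
  have hb := (MvPolynomial.basisMonomials (Fin d × Fin d) ℂ).constr_basis ℂ
    (Function.extend cnt (fun fg => T fg.1 fg.2) 0) (cnt (f, g))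
  rw [MvPolynomial.coe_basisMonomials] at hb
  rw [hb, hfac.extend_apply, smul_eq_mul]

end Types

/-! ### Comparing highest weight vectors of equal weight -/

section HighestWeight

variable {d : ℕ} {ι : Type} [Fintype ι] [DecidableEq ι]

lemma star_dotProduct_mulVec {m n : Type*} [Fintype m] [Fintype n] (M : Matrix m n ℂ)
    (y : m → ℂ) (z : n → ℂ) : star y ⬝ᵥ (M *ᵥ z) = star (Mᴴ *ᵥ y) ⬝ᵥ z := by
  rw [Matrix.star_mulVec, Matrix.conjTranspose_conjTranspose, Matrix.dotProduct_mulVec]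

lemma IsHighestWeight.form_mul_upper {lam : Fin d → ℕ} {y : (ι → Fin d) → ℂ}
    (hy : IsHighestWeight lam y) (X U : Matrix (Fin d) (Fin d) ℂ) (hU : IsUpperUnipotent U) :
    star y ⬝ᵥ (tensorMat (fun _ => X * U) *ᵥ y) = star y ⬝ᵥ (tensorMat (fun _ => X) *ᵥ y) := by
  rw [← tensorMat_mul, ← Matrix.mulVec_mulVec, hy.fixed U hU]

lemma IsHighestWeight.form_lower_mul {lam : Fin d → ℕ} {y : (ι → Fin d) → ℂ}
    (hy : IsHighestWeight lam y) (X L : Matrix (Fin d) (Fin d) ℂ) (hL : IsUpperUnipotent Lᴴ) :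
    star y ⬝ᵥ (tensorMat (fun _ => L * X) *ᵥ y) = star y ⬝ᵥ (tensorMat (fun _ => X) *ᵥ y) := by
  rw [← tensorMat_mul, ← Matrix.mulVec_mulVec, star_dotProduct_mulVec, tensorMat_conjTranspose,
    hy.fixed _ hL]

lemma IsHighestWeight.form_diagonal {lam : Fin d → ℕ} {y : (ι → Fin d) → ℂ}
    (hy : IsHighestWeight lam y) (D : Fin d → ℂ) :
    star y ⬝ᵥ (tensorMat (fun _ => Matrix.diagonal D) *ᵥ y) =
      (∏ i, D i ^ lam i) * (star y ⬝ᵥ y) := by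
  have : tensorMat (fun _ => Matrix.diagonal D) *ᵥ y = (∏ i, D i ^ lam i) • y := by
    ext f
    rw [tensorMat_diagonal, Matrix.mulVec_diagonal, Pi.smul_apply, smul_eq_mul]
    by_cases hf : y f = 0
    · simp [hf]
    · rw [prod_word, hy.weight f hf]
  rw [this, dotProduct_smul, smul_eq_mul]

lemma form_eq_sum (y : (ι → Fin d) → ℂ) (T : Matrix (ι → Fin d) (ι → Fin d) ℂ) :
    star y ⬝ᵥ (T *ᵥ y) = ∑ f, ∑ g, (star (y f) * y g) * T f g := by
  simp only [dotProduct, Matrix.mulVec, Finset.mul_sum, Pi.star_apply]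
  exact Finset.sum_congr rfl fun _ _ => Finset.sum_congr rfl fun _ _ => by ring

/-- Highest weight vectors of the same weight have proportional expectations of permutation
invariant operators. -/
lemma IsHighestWeight.form_proportional {lam : Fin d → ℕ} {y s : (ι → Fin d) → ℂ}
    (hy : IsHighestWeight lam y) (hs : IsHighestWeight lam s)
    {T : Matrix (ι → Fin d) (ι → Fin d) ℂ} (hT : PermInvariant T) :
    (star y ⬝ᵥ (T *ᵥ y)) * (star s ⬝ᵥ s) = (star s ⬝ᵥ (T *ᵥ s)) * (star y ⬝ᵥ y) := by
  -- Both expectations are polynomial in `X` and invariant under elimination; on a diagonal matrix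
  -- each is the same monomial times its squared norm.
  have hX : ∀ X : Matrix (Fin d) (Fin d) ℂ,
      (star y ⬝ᵥ (tensorMat (fun _ => X) *ᵥ y)) * (star s ⬝ᵥ s) -
        (star s ⬝ᵥ (tensorMat (fun _ => X) *ᵥ s)) * (star y ⬝ᵥ y) = 0 := by
    refine eq_zero_of_elimination ?_ ?_ ?_ ?_
    · simp only [form_eq_sum, tensorMat, Matrix.of_apply]
      fun_prop
    · intro X U hU
      rw [hy.form_mul_upper X U hU, hs.form_mul_upper X U hU]
    · intro X L hL
      rw [hy.form_lower_mul X L hL, hs.form_lower_mul X L hL]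
    · intro D
      rw [hy.form_diagonal, hs.form_diagonal]
      ring
  have hsum : ∀ T : Matrix (ι → Fin d) (ι → Fin d) ℂ,
      (star y ⬝ᵥ (T *ᵥ y)) * (star s ⬝ᵥ s) - (star s ⬝ᵥ (T *ᵥ s)) * (star y ⬝ᵥ y) =
      ∑ f, ∑ g, ((star (y f) * y g) * (star s ⬝ᵥ s) - (star (s f) * s g) * (star y ⬝ᵥ y)) *
        T f g := by
    intro T
    simp only [form_eq_sum, Finset.sum_mul, ← Finset.sum_sub_distrib]
    exact Finset.sum_congr rfl fun _ _ => Finset.sum_congr rfl fun _ _ => by ring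
  rw [← sub_eq_zero, hsum]
  exact sum_mul_permInvariant_eq_zero (fun X => by rw [← hsum, hX X]) hT

/-- A nonzero highest weight vector is not orthogonal to all relabellings of the antisymmetrised
row word. -/
lemma IsHighestWeight.exists_dotProduct_ne_zero {μ : YoungFrame d}
    {y : (μ.1.cells → Fin d) → ℂ} (hy : IsHighestWeight (fun i => μ.1.rowLen i) y) (hy0 : y ≠ 0) :
    ∃ σ : Equiv.Perm μ.1.cells, star (permMat d σ *ᵥ specht μ) ⬝ᵥ y ≠ 0 := by
  by_contra hno
  push Not at hno
  set s := specht μ with hs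
  -- Summing the rank-one operators of all relabellings of `s` gives an invariant operator. Its
  -- expectation in `y` vanishes if `y` is orthogonal to all of them, and then so does its
  -- expectation in `s`.
  set T : Matrix (μ.1.cells → Fin d) (μ.1.cells → Fin d) ℂ :=
    ∑ σ : Equiv.Perm μ.1.cells,
      Matrix.vecMulVec (permMat d σ *ᵥ s) (star (permMat d σ *ᵥ s)) with hTdef
  have hT : PermInvariant T := by
    intro ρ f g
    simp only [hTdef, Matrix.sum_apply, Matrix.vecMulVec_apply, permMat_mulVec, Pi.star_apply]
    exact Equiv.sum_comp (Equiv.mulLeft ρ) fun σ : Equiv.Perm μ.1.cells =>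
      s (f ∘ σ) * star (s (g ∘ σ))
  have hTv : ∀ v, T *ᵥ v = ∑ σ : Equiv.Perm μ.1.cells,
      (star (permMat d σ *ᵥ s) ⬝ᵥ v) • (permMat d σ *ᵥ s) := by
    intro v
    rw [hTdef, Matrix.sum_mulVec]
    refine Finset.sum_congr rfl fun σ _ => ?_
    rw [Matrix.vecMulVec_mulVec]
    ext f
    simp [mul_comm]
  have hprop := hy.form_proportional (isHighestWeight_specht μ) hT
  rw [← hs, hTv y, Finset.sum_congr rfl fun σ _ => by rw [hno σ, zero_smul], Finset.sum_const_zero,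
    dotProduct_zero, zero_mul] at hprop
  have hyy : star y ⬝ᵥ y ≠ 0 := by rwa [Ne, dotProduct_star_self_eq_zero]
  have hz := (mul_eq_zero.1 hprop.symm).resolve_right hyy
  rw [hTv s, dotProduct_sum] at hz
  have hterm : ∀ σ : Equiv.Perm μ.1.cells,
      star s ⬝ᵥ ((star (permMat d σ *ᵥ s) ⬝ᵥ s) • (permMat d σ *ᵥ s)) =
      star (star s ⬝ᵥ (permMat d σ *ᵥ s)) * (star s ⬝ᵥ (permMat d σ *ᵥ s)) := by
    intro σ
    rw [dotProduct_smul, smul_eq_mul, Matrix.star_dotProduct]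
  simp only [hterm] at hz
  -- All terms are squared moduli; the one of the identity is ‖s‖⁴, which is not zero.
  have h1 := (Finset.sum_eq_zero_iff_of_nonneg (fun σ _ => star_mul_self_nonneg _)).1 hz 1
    (Finset.mem_univ _)
  rw [permMat_one, Matrix.one_mulVec] at h1
  have hss : star s ⬝ᵥ s ≠ 0 := by
    rw [Ne, dotProduct_star_self_eq_zero]
    intro h0
    have := specht_rowWord μ
    rw [← hs, h0] at this
    simp at this
  simp [hss] at h1

/-- Some relabelled Young symmetriser does not kill a given nonzero highest weight vector. -/
lemma IsHighestWeight.exists_youngMat_ne_zero {μ : YoungFrame d} {y : (ι → Fin d) → ℂ}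
    (hy : IsHighestWeight (fun i => μ.1.rowLen i) y) (hy0 : y ≠ 0) (e : ι ≃ μ.1.cells) :
    ∃ τ : ι ≃ μ.1.cells, youngMat d μ.1 *ᵥ (permMat d τ *ᵥ y) ≠ 0 := by
  have hz0 : permMat d e *ᵥ y ≠ 0 := fun h => hy0 (by
    have := congrArg (fun v => permMat d e.symm *ᵥ v) h
    simpa [Matrix.mulVec_mulVec, permMat_symm_mul_self] using this)
  obtain ⟨σ, hσ⟩ := (hy.transport e).exists_dotProduct_ne_zero hz0
  refine ⟨e.trans σ.symm, fun h => hσ ?_⟩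
  -- The row-word coordinate of r c z is a nonzero multiple of the inner product of `specht μ` with
  -- z, because c is self-adjoint.
  have hw := youngMat_mulVec_rowWord μ (permMat d (e.trans σ.symm) *ᵥ y)
  rw [h, Pi.zero_apply, eq_comm, mul_eq_zero, or_iff_right (rowOrder_ne_zero μ.1)] at hw
  rw [← permMat_mul, ← Matrix.mulVec_mulVec] at hw
  have hadj := star_dotProduct_mulVec (permMat d σ.symm) (specht μ) (permMat d e *ᵥ y)
  rw [permMat_conjTranspose, Equiv.symm_symm] at hadj
  rw [← hadj, specht]
  have hadj2 := star_dotProduct_mulVec (colMat d μ.1) (Pi.single (rowWord μ) 1)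
    (permMat d σ.symm *ᵥ (permMat d e *ᵥ y))
  rw [colMat_conjTranspose] at hadj2
  rw [← hadj2]
  simpa [dotProduct, Pi.single_apply] using hw

end HighestWeight

/-! ### Orthogonal projections and their diagonals -/

section Projections

variable {n : Type*} [Fintype n] [DecidableEq n]

/-- The matrix of the orthogonal projection onto a subspace. -/
lemma exists_isStarProjection (S : Submodule ℂ (n → ℂ)) :
    ∃ Q : Matrix n n ℂ, IsStarProjection Q ∧ (∀ v, Q *ᵥ v ∈ S) ∧ (∀ v ∈ S, Q *ᵥ v = v) ∧
      Q.trace = Module.finrank ℂ S := by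
  let e := (WithLp.linearEquiv 2 ℂ (n → ℂ)).symm
  let K : Submodule ℂ (EuclideanSpace ℂ n) := S.map e.toLinearMap
  let Φ := Matrix.toEuclideanCLM (n := n) (𝕜 := ℂ)
  let Q := Φ.symm K.starProjection
  have hQ : ∀ v, WithLp.toLp 2 (Q *ᵥ v) = K.starProjection (WithLp.toLp 2 v) := by
    intro v
    rw [← Matrix.toEuclideanCLM_toLp]
    change (Φ (Φ.symm K.starProjection)) _ = _
    rw [StarAlgEquiv.apply_symm_apply]
  have hmem : ∀ v, Q *ᵥ v ∈ S := by
    intro v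
    have h : K.starProjection (WithLp.toLp 2 v) ∈ K := K.starProjection_apply_mem _
    rw [← hQ] at h
    obtain ⟨w, hw, he⟩ := h
    rwa [← (WithLp.toLp_injective 2 he)]
  have hid : ∀ v ∈ S, Q *ᵥ v = v := by
    intro v hv
    apply WithLp.toLp_injective 2
    rw [hQ, Submodule.starProjection_eq_self_iff]
    exact ⟨v, hv, rfl⟩
  have hP : IsStarProjection K.starProjection := isStarProjection_starProjection
  have hproj : IsStarProjection Q := by
    refine ⟨?_, ?_⟩
    · change Φ.symm K.starProjection * Φ.symm K.starProjection = Φ.symm K.starProjection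
      rw [← map_mul, hP.isIdempotentElem.eq]
    · change star (Φ.symm K.starProjection) = Φ.symm K.starProjection
      apply EquivLike.injective Φ
      rw [map_star Φ, StarAlgEquiv.apply_symm_apply, hP.isSelfAdjoint.star_eq]
  refine ⟨Q, hproj, hmem, hid, ?_⟩
  rw [← Matrix.trace_toLin'_eq]
  exact LinearMap.IsProj.trace ⟨fun v => by simpa using hmem v, fun v hv => by simpa using hid v hv⟩

lemma IsStarProjection.conjTranspose_eq {Q : Matrix n n ℂ} (hQ : IsStarProjection Q) :
    Qᴴ = Q := hQ.isSelfAdjoint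

lemma IsStarProjection.mul_self_eq {Q : Matrix n n ℂ} (hQ : IsStarProjection Q) :
    Q * Q = Q := hQ.isIdempotentElem

/-- The projection onto a subspace preserved by `T` and its adjoint commutes with `T`. -/
lemma commute_of_invariant {S : Submodule ℂ (n → ℂ)} {Q T : Matrix n n ℂ}
    (hQ : IsStarProjection Q) (hmem : ∀ v, Q *ᵥ v ∈ S) (hid : ∀ v ∈ S, Q *ᵥ v = v)
    (hT : ∀ v ∈ S, T *ᵥ v ∈ S) (hT' : ∀ v ∈ S, Tᴴ *ᵥ v ∈ S) : Q * T = T * Q := by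
  have key : ∀ T : Matrix n n ℂ, (∀ v ∈ S, T *ᵥ v ∈ S) → Q * T * Q = T * Q := by
    intro T hT
    refine Matrix.mulVec_injective (funext fun v => ?_)
    simp only [← Matrix.mulVec_mulVec]
    exact hid _ (hT _ (hmem v))
  have h1 := key T hT
  have h2 := congrArg Matrix.conjTranspose (key _ hT')
  simp only [Matrix.conjTranspose_mul, Matrix.conjTranspose_conjTranspose,
    hQ.conjTranspose_eq] at h2
  rw [← h2, ← Matrix.mul_assoc, h1]

/-- This is the diagonal entry of Q = Qᴴ Q. -/
lemma IsStarProjection.sum_normSq_col {Q : Matrix n n ℂ} (hQ : IsStarProjection Q) (f : n) :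
    ∑ g, Complex.normSq (Q g f) = (Q f f).re := by
  have h : Q f f = ∑ g, star (Q g f) * Q g f := by
    conv_lhs => rw [← hQ.mul_self_eq, Matrix.mul_apply]
    refine Finset.sum_congr rfl fun g _ => ?_
    conv_lhs => rw [← hQ.conjTranspose_eq]
    rw [Matrix.conjTranspose_apply, hQ.conjTranspose_eq]
  rw [h, Complex.re_sum]
  refine Finset.sum_congr rfl fun g _ => ?_
  rw [Complex.star_def, ← Complex.normSq_eq_conj_mul_self, Complex.ofReal_re]

lemma IsStarProjection.diag_re_nonneg {Q : Matrix n n ℂ} (hQ : IsStarProjection Q) (f : n) :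
    0 ≤ (Q f f).re := by
  rw [← hQ.sum_normSq_col]
  exact Finset.sum_nonneg fun _ _ => Complex.normSq_nonneg _

lemma IsStarProjection.diag_re_le_one {Q : Matrix n n ℂ} (hQ : IsStarProjection Q) (f : n) :
    (Q f f).re ≤ 1 := by
  have h := hQ.one_sub.diag_re_nonneg f
  simpa using h

lemma IsStarProjection.col_eq_zero {Q : Matrix n n ℂ} (hQ : IsStarProjection Q) {f : n}
    (hf : (Q f f).re = 0) (g : n) : Q g f = 0 := by
  rw [← hQ.sum_normSq_col, Finset.sum_eq_zero_iff_of_nonneg fun _ _ => Complex.normSq_nonneg _]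
    at hf
  exact Complex.normSq_eq_zero.1 (hf g (Finset.mem_univ g))

/-- A vector in the range of `Q`, supported on `s`, forces the diagonal of `Q` over `s` to have
sum at least one. -/
lemma IsStarProjection.one_le_sum_diag {Q : Matrix n n ℂ} (hQ : IsStarProjection Q)
    {y : n → ℂ} (hy0 : y ≠ 0) (hy : Q *ᵥ y = y) (s : Finset n) (hs : ∀ f, y f ≠ 0 → f ∈ s) :
    1 ≤ ∑ f ∈ s, (Q f f).re := by
  set N := ∑ g, Complex.normSq (y g) with hN
  have hNpos : 0 < N := by
    obtain ⟨f, hf⟩ := Function.ne_iff.1 hy0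
    exact Finset.sum_pos' (fun _ _ => Complex.normSq_nonneg _)
      ⟨f, Finset.mem_univ f, Complex.normSq_pos.2 hf⟩
  -- Cauchy–Schwarz applied to y = Q y, with row `f` of `Q` having squared norm `Q f f`.
  have hbound : ∀ f, Complex.normSq (y f) ≤ (Q f f).re * N := by
    intro f
    have h1 : y f = ∑ g, Q f g * y g := by
      conv_lhs => rw [← hy]
      rfl
    have h2 : ‖y f‖ ≤ ∑ g, ‖Q f g‖ * ‖y g‖ := by
      rw [h1]
      exact (norm_sum_le _ _).trans (Finset.sum_le_sum fun g _ => (norm_mul _ _).le)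
    have h3 := Finset.sum_mul_sq_le_sq_mul_sq Finset.univ (fun g => ‖Q f g‖) (fun g => ‖y g‖)
    have h4 : ∑ g, ‖Q f g‖ ^ 2 = (Q f f).re := by
      rw [← hQ.sum_normSq_col]
      refine Finset.sum_congr rfl fun g _ => ?_
      rw [← Complex.normSq_eq_norm_sq, ← Complex.normSq_conj]
      congr 1
      conv_rhs => rw [← hQ.conjTranspose_eq]
      rfl
    have h5 : ∑ g, ‖y g‖ ^ 2 = N := by simp only [hN, Complex.normSq_eq_norm_sq]
    rw [h4, h5] at h3
    rw [Complex.normSq_eq_norm_sq]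
    exact (pow_le_pow_left₀ (norm_nonneg _) h2 2).trans h3
  have hsum : N = ∑ f ∈ s, Complex.normSq (y f) := by
    rw [hN]
    refine (Finset.sum_subset (Finset.subset_univ s) fun f _ hf => ?_).symm
    by_contra h
    exact hf (hs f fun h0 => h (by rw [h0, map_zero]))
  have : N ≤ (∑ f ∈ s, (Q f f).re) * N := by
    conv_lhs => rw [hsum]
    rw [Finset.sum_mul]
    exact Finset.sum_le_sum fun f _ => hbound f
  by_contra hlt
  push Not at hlt
  nlinarith

end Projections

/-! ### Extremal words give highest weight vectors -/

section Extremal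

variable {d : ℕ} {ι : Type} [Fintype ι] [DecidableEq ι]

/-- The surplus of `j` over `i` moves from the smaller value `r j` to the larger `r i`. -/
lemma prod_word_swap_le {r : Fin d → ℝ} (hr : Antitone r) (hr0 : ∀ i, 0 ≤ r i) (f : ι → Fin d)
    {i j : Fin d} (hij : i < j) (hc : content f i < content f j) :
    ∏ p, r (f p) ≤ ∏ p, r (Equiv.swap i j (f p)) := by
  rw [prod_word f r, prod_word f fun k => r (Equiv.swap i j k)]
  have hj : j ∈ Finset.univ.erase i := Finset.mem_erase.2 ⟨hij.ne', Finset.mem_univ j⟩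
  rw [← Finset.mul_prod_erase _ _ (Finset.mem_univ i), ← Finset.mul_prod_erase _ _ hj,
    ← Finset.mul_prod_erase Finset.univ (fun k => r (Equiv.swap i j k) ^ content f k)
      (Finset.mem_univ i), ← Finset.mul_prod_erase _ _ hj]
  have hrest : ∏ k ∈ (Finset.univ.erase i).erase j, r (Equiv.swap i j k) ^ content f k =
      ∏ k ∈ (Finset.univ.erase i).erase j, r k ^ content f k := by
    refine Finset.prod_congr rfl fun k hk => ?_
    simp only [Finset.mem_erase] at hk
    rw [Equiv.swap_apply_of_ne_of_ne hk.2.1 hk.1]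
  rw [hrest, ← mul_assoc, ← mul_assoc]
  refine mul_le_mul_of_nonneg_right ?_
    (Finset.prod_nonneg fun k _ => pow_nonneg (hr0 k) _)
  simp only [Equiv.swap_apply_left, Equiv.swap_apply_right]
  obtain ⟨c, hcc⟩ := Nat.exists_eq_add_of_lt hc
  rw [hcc]
  have h1 : r j ^ (c + 1) ≤ r i ^ (c + 1) := pow_le_pow_left₀ (hr0 j) (hr hij.le) _
  have h2 : 0 ≤ r i ^ content f i * r j ^ content f i :=
    mul_nonneg (pow_nonneg (hr0 i) _) (pow_nonneg (hr0 j) _)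
  calc r i ^ content f i * r j ^ (content f i + c + 1)
      = r i ^ content f i * r j ^ content f i * r j ^ (c + 1) := by ring
    _ ≤ r i ^ content f i * r j ^ content f i * r i ^ (c + 1) := mul_le_mul_of_nonneg_left h1 h2
    _ = r j ^ content f i * r i ^ (content f i + c + 1) := by ring

/-- The same swap strictly lowers the sum of the letters, which serves as tie-breaker when the
product of the `r` values is unchanged. -/
lemma sum_word_swap_lt (f : ι → Fin d) {i j : Fin d} (hij : i < j)
    (hc : content f i < content f j) :
    ∑ p, (Equiv.swap i j (f p) : ℕ) < ∑ p, (f p : ℕ) := by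
  have hsum : ∀ r : Fin d → ℕ, ∑ p, r (f p) = ∑ k, content f k * r k := fun r => by
    rw [← Finset.sum_fiberwise' Finset.univ f r]
    simp [content]
  rw [hsum fun k => (k : ℕ), hsum fun k => (Equiv.swap i j k : ℕ)]
  have hj : j ∈ Finset.univ.erase i := Finset.mem_erase.2 ⟨hij.ne', Finset.mem_univ j⟩
  rw [← Finset.add_sum_erase _ _ (Finset.mem_univ i), ← Finset.add_sum_erase _ _ hj,
    ← Finset.add_sum_erase Finset.univ (fun k => content f k * (k : ℕ)) (Finset.mem_univ i),
    ← Finset.add_sum_erase _ _ hj]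
  have hrest : ∑ k ∈ (Finset.univ.erase i).erase j, content f k * (Equiv.swap i j k : ℕ) =
      ∑ k ∈ (Finset.univ.erase i).erase j, content f k * (k : ℕ) := by
    refine Finset.sum_congr rfl fun k hk => ?_
    simp only [Finset.mem_erase] at hk
    rw [Equiv.swap_apply_of_ne_of_ne hk.2.1 hk.1]
  rw [hrest, ← add_assoc, ← add_assoc]
  refine Nat.add_lt_add_right ?_ _
  simp only [Equiv.swap_apply_left, Equiv.swap_apply_right]
  have hij' : (i : ℕ) < j := hij
  nlinarith

/-- An invariant subspace contains a highest weight vector whose weight is extremal for a given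
nonincreasing function of the letters. -/
lemma exists_extremal {Q : Matrix (ι → Fin d) (ι → Fin d) ℂ} (hQ : IsStarProjection Q)
    (hcomm : ∀ T, PermInvariant T → Q * T = T * Q) (hQ0 : Q ≠ 0) {r : Fin d → ℝ}
    (hr : Antitone r) (hr0 : ∀ i, 0 ≤ r i) :
    ∃ (f : ι → Fin d) (y : (ι → Fin d) → ℂ), y ≠ 0 ∧ Q *ᵥ y = y ∧
      IsHighestWeight (content f) y ∧ Antitone (content f) ∧
      ∀ g, (Q g g).re ≠ 0 → ∏ p, r (g p) ≤ ∏ p, r (f p) := by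
  have hne : (Finset.univ.filter fun g : ι → Fin d => (Q g g).re ≠ 0).Nonempty := by
    by_contra h
    rw [Finset.not_nonempty_iff_eq_empty, Finset.filter_eq_empty_iff] at h
    refine hQ0 (Matrix.ext fun f g => hQ.col_eq_zero ?_ f)
    simpa using h (Finset.mem_univ g)
  -- Lexicographic choice: the largest product of `r` values, then the smallest sum of letters. The
  -- second criterion is needed since `r` may have equal or zero values. The vector sought is the
  -- column of `Q` at `f`.
  obtain ⟨f, hf, hmin⟩ := Finset.exists_min_image _
    (fun g : ι → Fin d => toLex (-∏ p, r (g p), ∑ p, (g p : ℕ))) hne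
  simp only [Finset.mem_filter, Finset.mem_univ, true_and] at hf hmin
  simp only [Prod.Lex.toLex_le_toLex, neg_lt_neg_iff, neg_inj] at hmin
  have hmax : ∀ g, (Q g g).re ≠ 0 → ∏ p, r (g p) ≤ ∏ p, r (f p) := fun g hg => by
    rcases hmin g hg with h | h
    · exact h.le
    · exact h.1.ge
  have hheight : ∀ g, (Q g g).re ≠ 0 → ∏ p, r (f p) ≤ ∏ p, r (g p) →
      ∑ p, (f p : ℕ) ≤ ∑ p, (g p : ℕ) := fun g hg hle => by
    rcases hmin g hg with h | h
    · exact absurd h hle.not_gt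
    · exact h.2
  have hcol : ∀ g, Q *ᵥ Pi.single g 1 = fun h => Q h g := fun g => by
    ext h; simp
  refine ⟨f, Q *ᵥ Pi.single f 1, ?_, ?_, ⟨?_, ?_⟩, ?_, hmax⟩
  · intro h0
    have := congrFun h0 f
    rw [hcol] at this
    exact hf (by simp [this])
  · rw [Matrix.mulVec_mulVec, hQ.mul_self_eq]
  · intro g hg
    by_contra hne
    -- The projection onto words with the content of `f` is invariant, so it commutes with `Q`.
    have hT : PermInvariant (Matrix.diagonal fun h : ι → Fin d =>
        if content h = content f then (1 : ℂ) else 0) := by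
      intro σ h h'
      have : h ∘ σ = h' ∘ σ ↔ h = h' := σ.surjective.injective_comp_right.eq_iff
      simp only [Matrix.diagonal_apply, this, content_comp]
    have h := congrFun (congrFun (hcomm _ hT) g) f
    rw [Matrix.mul_diagonal, Matrix.diagonal_mul, if_pos rfl, if_neg hne, mul_one, zero_mul] at h
    rw [hcol] at hg
    exact hg h
  · intro U hU
    rw [Matrix.mulVec_mulVec, ← hcomm _ (permInvariant_tensorMat U), ← Matrix.mulVec_mulVec]
    have hexp : tensorMat (fun _ : ι => U) *ᵥ Pi.single f 1 =
        ∑ g, (∏ p, U (g p) (f p)) • Pi.single g (1 : ℂ) := by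
      ext f
      simp [tensorMat, Finset.sum_apply, Pi.single_apply]
    rw [hexp, Matrix.mulVec_sum, Finset.sum_eq_single f]
    · simp [hU.diag]
    · intro g _ hg
      rw [Matrix.mulVec_smul]
      by_cases hle : ∀ x, g x ≤ f x
      -- A word strictly below `f` has at least as large a product and a smaller sum, so by the
      -- choice of `f` its column in `Q` is zero.
      · have hzero : (Q g g).re = 0 := by
          by_contra hgg
          have h1 := hheight g hgg
            (Finset.prod_le_prod (fun _ _ => hr0 _) fun p _ => hr (hle p))
          obtain ⟨p, hp⟩ := Function.ne_iff.1 hg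
          exact absurd h1 (not_le.2 (Finset.sum_lt_sum (fun p _ => hle p)
            ⟨p, Finset.mem_univ p, lt_of_le_of_ne (hle p) (Fin.val_ne_of_ne hp)⟩))
        rw [hcol, show (fun h => Q h g) = 0 from funext fun h => hQ.col_eq_zero hzero h, smul_zero]
      · push Not at hle
        obtain ⟨x, hx⟩ := hle
        rw [Finset.prod_eq_zero (Finset.mem_univ x) (hU.lower _ _ hx), zero_smul]
    · simp
  · intro i j hij
    rcases hij.eq_or_lt with rfl | hlt
    · exact le_rfl
    by_contra hc
    push Not at hc
    let s := Equiv.swap i j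
    -- Exchanging two letters throughout a word commutes with `Q`, so `s ∘ f` has the same diagonal
    -- entry as `f`; with a wrongly ordered content it would beat `f`.
    have hT : PermInvariant (Matrix.of fun g h : ι → Fin d =>
        if g = s ∘ h then (1 : ℂ) else 0) := by
      intro σ h h'
      have : h ∘ σ = s ∘ h' ∘ σ ↔ h = s ∘ h' :=
        (σ.surjective.injective_comp_right (γ := Fin d)).eq_iff (a := h) (b := s ∘ h')
      simp only [Matrix.of_apply, this]
    have h := congrFun (congrFun (hcomm _ hT) (s ∘ f)) f
    have hinj : ∀ g : ι → Fin d, s ∘ f = s ∘ g ↔ f = g := fun g =>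
      (s.injective.comp_left (α := ι)).eq_iff
    simp only [Matrix.mul_apply, Matrix.of_apply, hinj] at h
    simp only [mul_ite, mul_one, mul_zero, Finset.sum_ite_eq', Finset.mem_univ, if_true, ite_mul,
      one_mul, zero_mul, Finset.sum_ite_eq] at h
    have h1 := hheight (s ∘ f) (by rwa [h]) (prod_word_swap_le hr hr0 f hlt hc)
    exact absurd h1 (not_le.2 (sum_word_swap_lt f hlt hc))

end Extremal

/-! ### Cyclic subspaces have polynomial dimension -/

section Cyclic

variable {d : ℕ} {ι : Type} [Fintype ι] [DecidableEq ι]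

/-- The joint type of two words: the numbers of occurrences of each pair of letters. -/
def jointType (f g : ι → Fin d) (a : Fin d × Fin d) : Fin (Fintype.card ι + 1) :=
  ⟨(Finset.univ.filter fun p => (f p, g p) = a).card, Nat.lt_succ_of_le (Finset.card_le_univ _)⟩

/-- The operators that depend on the joint type only, applied to a vector. -/
def cyclicMap (y : (ι → Fin d) → ℂ) :
    ((Fin d × Fin d → Fin (Fintype.card ι + 1)) → ℂ) →ₗ[ℂ] ((ι → Fin d) → ℂ) where
  toFun a := (Matrix.of fun f g => a (jointType f g)) *ᵥ y
  map_add' a b := by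
    rw [← Matrix.add_mulVec]; rfl
  map_smul' c a := by
    rw [RingHom.id_apply, ← Matrix.smul_mulVec]; rfl

lemma permInvariant_jointType (a : (Fin d × Fin d → Fin (Fintype.card ι + 1)) → ℂ) :
    PermInvariant (Matrix.of fun f g : ι → Fin d => a (jointType f g)) := by
  intro σ f g
  simp only [Matrix.of_apply]
  congr 1
  ext x
  simp only [jointType, Function.comp_apply, ← Fintype.card_subtype]
  exact Fintype.card_congr (σ.subtypeEquiv fun _ => Iff.rfl)

lemma PermInvariant.exists_eq_jointType {T : Matrix (ι → Fin d) (ι → Fin d) ℂ}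
    (hT : PermInvariant T) : ∃ a : (Fin d × Fin d → Fin (Fintype.card ι + 1)) → ℂ,
      T = Matrix.of fun f g => a (jointType f g) := by
  have hfac : Function.FactorsThrough (fun fg : (ι → Fin d) × (ι → Fin d) => T fg.1 fg.2)
      (fun fg => jointType fg.1 fg.2) := by
    intro x y hxy
    exact hT.eq_of_card_eq fun a => congrArg Fin.val (congrFun hxy a)
  refine ⟨Function.extend (fun fg : (ι → Fin d) × (ι → Fin d) => jointType fg.1 fg.2)
    (fun fg => T fg.1 fg.2) 0, ?_⟩
  ext f g
  exact (hfac.extend_apply 0 (f, g)).symm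

lemma PermInvariant.mulVec_mem_range_cyclicMap {T : Matrix (ι → Fin d) (ι → Fin d) ℂ}
    (hT : PermInvariant T) (y : (ι → Fin d) → ℂ) : T *ᵥ y ∈ LinearMap.range (cyclicMap y) := by
  obtain ⟨a, rfl⟩ := hT.exists_eq_jointType
  exact ⟨a, rfl⟩

lemma finrank_range_cyclicMap_le (y : (ι → Fin d) → ℂ) :
    Module.finrank ℂ (LinearMap.range (cyclicMap y)) ≤ (Fintype.card ι + 1) ^ (d * d) := by
  refine (LinearMap.finrank_range_le _).trans ?_
  simp

lemma permInvariant_one : PermInvariant (1 : Matrix (ι → Fin d) (ι → Fin d) ℂ) := by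
  rw [← tensorMat_one]
  exact permInvariant_tensorMat 1

/-- The projection onto the invariant subspace generated by a vector. -/
lemma exists_cyclic_projection (y : (ι → Fin d) → ℂ) :
    ∃ Q : Matrix (ι → Fin d) (ι → Fin d) ℂ, IsStarProjection Q ∧
      (∀ T, PermInvariant T → Q * T = T * Q) ∧ Q *ᵥ y = y ∧
      (∀ v, ∃ T, PermInvariant T ∧ Q *ᵥ v = T *ᵥ y) ∧
      Q.trace.re ≤ ((Fintype.card ι + 1 : ℕ) : ℝ) ^ (d * d) := by
  obtain ⟨Q, hQ, hmem, hid, htr⟩ := exists_isStarProjection (LinearMap.range (cyclicMap y))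
  have hinv : ∀ T, PermInvariant T → ∀ v ∈ LinearMap.range (cyclicMap y),
      T *ᵥ v ∈ LinearMap.range (cyclicMap y) := by
    rintro T hT _ ⟨a, rfl⟩
    have h : T *ᵥ cyclicMap y a = (T * Matrix.of fun f g => a (jointType f g)) *ᵥ y := by
      rw [← Matrix.mulVec_mulVec]; rfl
    rw [h]
    exact (hT.mul (permInvariant_jointType a)).mulVec_mem_range_cyclicMap y
  refine ⟨Q, hQ, fun T hT => commute_of_invariant hQ hmem hid (hinv T hT)
    (hinv _ hT.conjTranspose), ?_, ?_, ?_⟩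
  · have h := permInvariant_one.mulVec_mem_range_cyclicMap y
    rw [Matrix.one_mulVec] at h
    exact hid y h
  · intro v
    obtain ⟨a, ha⟩ := hmem v
    exact ⟨_, permInvariant_jointType a, ha.symm⟩
  · rw [htr, Complex.natCast_re, ← Nat.cast_pow]
    exact Nat.cast_le.2 (finrank_range_cyclicMap_le y)

end Cyclic

/-! ### Weight of an invariant projection -/

section WeightEstimate

variable {d : ℕ} {ι : Type} [Fintype ι] [DecidableEq ι]

/-- The hypothesis puts the range of `P` inside that of `Q`; taking adjoints gives P Q = P as well.
-/
lemma IsStarProjection.sub_of_mul_eq {n : Type*} [Fintype n] [DecidableEq n] {Q P : Matrix n n ℂ}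
    (hQ : IsStarProjection Q) (hP : IsStarProjection P) (h : Q * P = P) :
    IsStarProjection (Q - P) := by
  have h' : P * Q = P := by
    have := congrArg Matrix.conjTranspose h
    rwa [Matrix.conjTranspose_mul, hQ.conjTranspose_eq, hP.conjTranspose_eq] at this
  refine ⟨?_, hQ.isSelfAdjoint.sub hP.isSelfAdjoint⟩
  change (Q - P) * (Q - P) = Q - P
  rw [sub_mul, mul_sub, mul_sub, hQ.mul_self_eq, hP.mul_self_eq, h, h', sub_self, sub_zero]

/-- The weighted diagonal of an invariant projection is controlled by the words whose content is
a highest weight occurring in it. -/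
lemma sum_diag_le {r : Fin d → ℝ} (hr : Antitone r) (hr0 : ∀ i, 0 ≤ r i)
    (Λ : (Fin d → ℕ) → Prop) [DecidablePred Λ] {Q : Matrix (ι → Fin d) (ι → Fin d) ℂ}
    (hQ : IsStarProjection Q) (hcomm : ∀ T, PermInvariant T → Q * T = T * Q)
    (hΛ : ∀ lam y, y ≠ 0 → Q *ᵥ y = y → IsHighestWeight lam y → Antitone lam → Λ lam) :
    ∑ f, (∏ p, r (f p)) * (Q f f).re ≤ ((Fintype.card ι + 1 : ℕ) : ℝ) ^ (d * d) *
      ∑ f with Λ (content f), (∏ p, r (f p)) * (Q f f).re := by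
  -- Induction on an integer bound for the trace; every projection split off has trace at least one.
  obtain ⟨n, hn⟩ := exists_nat_ge Q.trace.re
  induction n generalizing Q with
  | zero =>
    have hdiag : ∀ f, (Q f f).re = 0 := by
      have h0 : ∑ f, (Q f f).re ≤ 0 := by simpa [Matrix.trace, Complex.re_sum] using hn
      have h1 := (Finset.sum_eq_zero_iff_of_nonneg fun f _ => hQ.diag_re_nonneg f).1
        (le_antisymm h0 (Finset.sum_nonneg fun f _ => hQ.diag_re_nonneg f))
      exact fun f => h1 f (Finset.mem_univ f)
    simp [hdiag]
  | succ n ih =>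
    by_cases hQ0 : Q = 0
    · simp [hQ0]
    obtain ⟨f₀, y, hy0, hQy, hhw, hanti, hmax⟩ := exists_extremal hQ hcomm hQ0 hr hr0
    obtain ⟨P, hP, hPcomm, hPy, hPmem, hPtr⟩ := exists_cyclic_projection y
    -- The range of `P` consists of vectors `T y` with `T` invariant, and `Q` commutes with `T` and
    -- fixes `y`.
    have hQP : Q * P = P := by
      refine Matrix.mulVec_injective (funext fun v => ?_)
      obtain ⟨T, hT, hv⟩ := hPmem v
      rw [← Matrix.mulVec_mulVec, hv, Matrix.mulVec_mulVec, hcomm T hT, ← Matrix.mulVec_mulVec,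
        hQy]
    have hsub := hQ.sub_of_mul_eq hP hQP
    have hone : 1 ≤ ∑ f with content f = content f₀, (P f f).re :=
      hP.one_le_sum_diag hy0 hPy _ fun f hf => by simpa using hhw.weight f hf
    have hPtr1 : 1 ≤ P.trace.re := by
      rw [Matrix.trace, Complex.re_sum]
      exact hone.trans (Finset.sum_le_sum_of_subset_of_nonneg (Finset.subset_univ _)
        fun f _ _ => hP.diag_re_nonneg f)
    have hrest := ih hsub (fun T hT => by rw [sub_mul, mul_sub, hcomm T hT, hPcomm T hT])
      (fun lam z hz0 hz hhwz hantiz => by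
        refine hΛ lam z hz0 ?_ hhwz hantiz
        rw [← hz, Matrix.mulVec_mulVec, mul_sub, hQ.mul_self_eq, hQP])
      (by
        rw [Matrix.trace_sub, Complex.sub_re]
        push_cast at hn
        linarith)
    have hw : ∀ f : ι → Fin d, 0 ≤ ∏ p, r (f p) := fun f =>
      Finset.prod_nonneg fun p _ => hr0 _
    -- Words on the diagonal of `P` occur on that of `Q`, since `Q - P` has nonnegative diagonal,
    -- and among those `f₀` has maximal weight.
    have hPle : ∑ f, (∏ p, r (f p)) * (P f f).re ≤ (∏ p, r (f₀ p)) * P.trace.re := by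
      rw [Matrix.trace, Complex.re_sum, Finset.mul_sum]
      refine Finset.sum_le_sum fun f _ => ?_
      by_cases hf : (Q f f).re = 0
      · have h1 := hsub.diag_re_nonneg f
        rw [Matrix.sub_apply, Complex.sub_re, hf] at h1
        have h2 := hP.diag_re_nonneg f
        have h3 : (P f f).re = 0 := by linarith
        simp [h3]
      · exact mul_le_mul_of_nonneg_right (hmax f hf) (hP.diag_re_nonneg f)
    have hΛ0 : Λ (content f₀) := hΛ _ y hy0 hQy hhw hanti
    -- Words with the content of `f₀` all have its weight, and `y`, supported on them, forces the
    -- diagonal of `P` there to sum to at least one.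
    have hPge : (∏ p, r (f₀ p)) ≤ ∑ f with Λ (content f), (∏ p, r (f p)) * (P f f).re := by
      calc (∏ p, r (f₀ p)) ≤ (∏ p, r (f₀ p)) * ∑ f with content f = content f₀, (P f f).re :=
            le_mul_of_one_le_right (hw f₀) hone
        _ = ∑ f with content f = content f₀, (∏ p, r (f p)) * (P f f).re := by
            rw [Finset.mul_sum]
            refine Finset.sum_congr rfl fun f hf => ?_
            rw [prod_word f₀ r, prod_word f r, (Finset.mem_filter.1 hf).2]
        _ ≤ _ := by
            refine Finset.sum_le_sum_of_subset_of_nonneg ?_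
              fun f _ _ => mul_nonneg (hw f) (hP.diag_re_nonneg f)
            intro f hf
            have := (Finset.mem_filter.1 hf).2
            exact Finset.mem_filter.2 ⟨Finset.mem_univ f, by rwa [this]⟩
    have hN : (0 : ℝ) ≤ ((Fintype.card ι + 1 : ℕ) : ℝ) ^ (d * d) := by positivity
    have hPfinal : ∑ f, (∏ p, r (f p)) * (P f f).re ≤ ((Fintype.card ι + 1 : ℕ) : ℝ) ^ (d * d) *
        ∑ f with Λ (content f), (∏ p, r (f p)) * (P f f).re :=
      calc _ ≤ (∏ p, r (f₀ p)) * P.trace.re := hPle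
        _ ≤ (∏ p, r (f₀ p)) * ((Fintype.card ι + 1 : ℕ) : ℝ) ^ (d * d) :=
            mul_le_mul_of_nonneg_left hPtr (hw f₀)
        _ = ((Fintype.card ι + 1 : ℕ) : ℝ) ^ (d * d) * ∏ p, r (f₀ p) := mul_comm _ _
        _ ≤ _ := mul_le_mul_of_nonneg_left hPge hN
    have hsplit : ∀ s : Finset (ι → Fin d), ∑ f ∈ s, (∏ p, r (f p)) * (Q f f).re =
        ∑ f ∈ s, (∏ p, r (f p)) * ((Q - P) f f).re + ∑ f ∈ s, (∏ p, r (f p)) * (P f f).re := by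
      intro s
      rw [← Finset.sum_add_distrib]
      refine Finset.sum_congr rfl fun f _ => ?_
      rw [Matrix.sub_apply, Complex.sub_re]
      ring
    rw [hsplit, hsplit, mul_add]
    exact add_le_add hrest hPfinal

end WeightEstimate

/-! ### Concentration of contents -/

section Concentration

/-- Chernoff bound for sums of independent letters. -/
lemma exists_chernoff {α : Type*} [Fintype α] {r h : α → ℝ} (hr0 : ∀ a, 0 ≤ r a)
    (hr1 : ∑ a, r a = 1) (hneg : ∑ a, r a * h a < 0) :
    ∃ q : ℝ, 0 < q ∧ q < 1 ∧ ∀ (ι : Type) [Fintype ι] [DecidableEq ι],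
      ∑ f : ι → α with 0 ≤ ∑ p, h (f p), ∏ p, r (f p) ≤ q ^ Fintype.card ι := by
  set M : ℝ → ℝ := fun t => ∑ a, r a * Real.exp (t * h a) with hM
  have hderiv : HasDerivAt M (∑ a, r a * h a) 0 := by
    have : ∀ a, HasDerivAt (fun t : ℝ => r a * Real.exp (t * h a)) (r a * h a) 0 := fun a => by
      have h1 := ((hasDerivAt_id (0 : ℝ)).mul_const (h a)).exp.const_mul (r a)
      simpa using h1
    exact HasDerivAt.fun_sum fun a _ => this a
  have hM0 : M 0 = 1 := by simp [hM, hr1]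
  -- The moment generating function is 1 at 0 with negative derivative there.
  obtain ⟨t, ht, ht0⟩ : ∃ t, M t < 1 ∧ 0 < t := by
    have h1 := hderiv.tendsto_slope.eventually (gt_mem_nhds hneg)
    have h2 : ∀ᶠ t in 𝓝[>] (0 : ℝ), slope M 0 t < 0 :=
      h1.filter_mono (nhdsWithin_mono _ fun x hx => ne_of_gt hx)
    obtain ⟨t, hs, ht⟩ := (h2.and self_mem_nhdsWithin).exists
    have ht' : 0 < t := ht
    refine ⟨t, ?_, ht'⟩
    rw [slope_def_field, hM0, sub_zero, div_neg_iff] at hs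
    rcases hs with hs | hs
    · linarith [hs.2]
    · linarith [hs.1]
  have hMnn : 0 ≤ M t := Finset.sum_nonneg fun a _ => mul_nonneg (hr0 a) (Real.exp_pos _).le
  -- The maximum with 1/2 makes positivity of `q` immediate.
  refine ⟨max (M t) (1 / 2), by positivity, max_lt ht (by norm_num), ?_⟩
  intro ι _ _
  calc ∑ f : ι → α with 0 ≤ ∑ p, h (f p), ∏ p, r (f p)
      ≤ ∑ f : ι → α with 0 ≤ ∑ p, h (f p), ∏ p, (r (f p) * Real.exp (t * h (f p))) := by
        refine Finset.sum_le_sum fun f hf => ?_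
        rw [Finset.prod_mul_distrib, ← Real.exp_sum, ← Finset.mul_sum]
        refine le_mul_of_one_le_right (Finset.prod_nonneg fun p _ => hr0 _) ?_
        exact Real.one_le_exp (mul_nonneg ht0.le (Finset.mem_filter.1 hf).2)
    _ ≤ ∑ f : ι → α, ∏ p, (r (f p) * Real.exp (t * h (f p))) :=
        Finset.sum_le_sum_of_subset_of_nonneg (Finset.subset_univ _) fun f _ _ =>
          Finset.prod_nonneg fun p _ => mul_nonneg (hr0 _) (Real.exp_pos _).le
    _ = M t ^ Fintype.card ι := by
        rw [← Fintype.piFinset_univ, ← Finset.prod_univ_sum (fun _ => Finset.univ)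
          (fun _ a => r a * Real.exp (t * h a))]
        simp [hM]
    _ ≤ _ := pow_le_pow_left₀ hMnn (le_max_left _ _) _

lemma tendsto_succ_pow_mul_pow (N : ℕ) {q : ℝ} (hq0 : 0 < q) (hq1 : q < 1) :
    Filter.Tendsto (fun k : ℕ => ((k + 1 : ℕ) : ℝ) ^ N * q ^ k) Filter.atTop (𝓝 0) := by
  have h := (tendsto_pow_const_mul_const_pow_of_abs_lt_one N
    (by rwa [abs_of_pos hq0] : |q| < 1)).comp (Filter.tendsto_add_atTop_nat 1)
  have h2 := h.mul_const q⁻¹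
  rw [zero_mul] at h2
  refine h2.congr fun k => ?_
  simp only [Function.comp_apply, pow_succ]
  field_simp

lemma sum_biUnion_le {α β : Type*} [DecidableEq α] [DecidableEq β] {w : β → ℝ}
    (hw : ∀ b, 0 ≤ w b) {s : Finset α} {t : α → Finset β} :
    ∑ b ∈ s.biUnion t, w b ≤ ∑ a ∈ s, ∑ b ∈ t a, w b := by
  induction s using Finset.induction_on with
  | empty => simp
  | insert a s ha ih =>
    rw [Finset.biUnion_insert, Finset.sum_insert ha]
    refine le_trans ?_ (add_le_add_right ih _)
    rw [← Finset.sum_union_inter]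
    exact le_add_of_nonneg_right (Finset.sum_nonneg fun b _ => hw b)

/-- A weight is `ε`-far from `k r` when some coordinate deviates by at least `ε k`. -/
def IsFar {d : ℕ} (r : Fin d → ℝ) (ε : ℝ) (k : ℕ) (lam : Fin d → ℕ) : Prop :=
  ∃ i, ε * k ≤ |(lam i : ℝ) - k * r i|

open Classical in
/-- The words with far content have superpolynomially small total weight. -/
lemma exists_far_bound {d : ℕ} {r : Fin d → ℝ} (hr0 : ∀ a, 0 ≤ r a) (hr1 : ∑ a, r a = 1)
    {ε : ℝ} (hε : 0 < ε) :
    ∃ β : ℕ → ℝ, (∀ N : ℕ, Filter.Tendsto (fun k : ℕ => ((k + 1 : ℕ) : ℝ) ^ N * β k)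
        Filter.atTop (𝓝 0)) ∧
      ∀ (ι : Type) [Fintype ι] [DecidableEq ι],
        ∑ f : ι → Fin d with IsFar r ε (Fintype.card ι) (content f), ∏ p, r (f p) ≤
          β (Fintype.card ι) := by
  -- These two families encode upward and downward deviations of letter `i`; each has mean -ε.
  have hup : ∀ i, ∑ a, r a * ((if a = i then 1 else 0) - r i - ε) < 0 := fun i => by
    simp only [mul_sub, Finset.sum_sub_distrib, ← Finset.sum_mul, hr1]
    simp [hε]
  have hlo : ∀ i, ∑ a, r a * (r i - ε - (if a = i then 1 else 0)) < 0 := fun i => by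
    simp only [mul_sub, Finset.sum_sub_distrib, ← Finset.sum_mul, hr1]
    simp [hε]
  choose q hq0 hq1 hq using fun i => exists_chernoff hr0 hr1 (hup i)
  choose q' hq0' hq1' hq' using fun i => exists_chernoff hr0 hr1 (hlo i)
  refine ⟨fun k => ∑ i, (q i ^ k + q' i ^ k), fun N => ?_, fun ι _ _ => ?_⟩
  · simp only [Finset.mul_sum, mul_add]
    have : Filter.Tendsto (fun k : ℕ => ∑ i, (((k + 1 : ℕ) : ℝ) ^ N * q i ^ k +
        ((k + 1 : ℕ) : ℝ) ^ N * q' i ^ k)) Filter.atTop (𝓝 (∑ _i : Fin d, ((0 : ℝ) + 0))) :=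
      tendsto_finsetSum _ fun i _ => (tendsto_succ_pow_mul_pow N (hq0 i) (hq1 i)).add
        (tendsto_succ_pow_mul_pow N (hq0' i) (hq1' i))
    simpa using this
  · have hcount : ∀ (f : ι → Fin d) i, ∑ p, (if f p = i then (1 : ℝ) else 0) = content f i :=
      fun f i => by simp [content, Finset.sum_boole]
    calc ∑ f : ι → Fin d with IsFar r ε (Fintype.card ι) (content f), ∏ p, r (f p)
        ≤ ∑ f ∈ Finset.univ.biUnion fun i =>
            (Finset.univ.filter fun f : ι → Fin d =>
              0 ≤ ∑ p, ((if f p = i then 1 else 0) - r i - ε)) ∪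
            (Finset.univ.filter fun f : ι → Fin d =>
              0 ≤ ∑ p, (r i - ε - (if f p = i then 1 else 0))), ∏ p, r (f p) := by
          refine Finset.sum_le_sum_of_subset_of_nonneg ?_
            fun f _ _ => Finset.prod_nonneg fun p _ => hr0 _
          intro f hf
          obtain ⟨i, hi⟩ := (Finset.mem_filter.1 hf).2
          refine Finset.mem_biUnion.2 ⟨i, Finset.mem_univ i, Finset.mem_union.2 ?_⟩
          simp only [Finset.mem_filter, Finset.mem_univ, true_and, Finset.sum_sub_distrib, hcount,
            Finset.sum_const, Finset.card_univ, nsmul_eq_mul]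
          rcases le_abs.1 hi with h | h
          · left; linarith
          · right; linarith
      _ ≤ ∑ i, ∑ f ∈ (Finset.univ.filter fun f : ι → Fin d =>
              0 ≤ ∑ p, ((if f p = i then 1 else 0) - r i - ε)) ∪
            (Finset.univ.filter fun f : ι → Fin d =>
              0 ≤ ∑ p, (r i - ε - (if f p = i then 1 else 0))), ∏ p, r (f p) :=
          sum_biUnion_le fun f => Finset.prod_nonneg fun p _ => hr0 _
      _ ≤ _ := by
          refine Finset.sum_le_sum fun i _ => ?_
          refine le_trans ?_ (add_le_add (hq i ι) (hq' i ι))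
          rw [← Finset.sum_union_inter]
          exact le_add_of_nonneg_right
            (Finset.sum_nonneg fun f _ => Finset.prod_nonneg fun p _ => hr0 _)

/-- Invariant projections all of whose highest weights are far have small expectation in tensor
powers of a diagonal state. -/
lemma exists_diag_bound {d : ℕ} {r : Fin d → ℝ} (hr : Antitone r) (hr0 : ∀ a, 0 ≤ r a)
    (hr1 : ∑ a, r a = 1) {ε : ℝ} (hε : 0 < ε) :
    ∃ β : ℕ → ℝ, Filter.Tendsto β Filter.atTop (𝓝 0) ∧
      ∀ (ι : Type) [Fintype ι] [DecidableEq ι] (Q : Matrix (ι → Fin d) (ι → Fin d) ℂ),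
        IsStarProjection Q → (∀ T, PermInvariant T → Q * T = T * Q) →
        (∀ lam y, y ≠ 0 → Q *ᵥ y = y → IsHighestWeight lam y → Antitone lam →
          IsFar r ε (Fintype.card ι) lam) →
        ∑ f, (∏ p, r (f p)) * (Q f f).re ≤ β (Fintype.card ι) := by
  classical
  obtain ⟨β, hβ, hfar⟩ := exists_far_bound hr0 hr1 hε
  -- The polynomial factor of `sum_diag_le` is absorbed by the superpolynomial decay.
  refine ⟨_, hβ (d * d), fun ι _ _ Q hQ hcomm hΛ => ?_⟩
  refine (sum_diag_le hr hr0 (IsFar r ε (Fintype.card ι)) hQ hcomm hΛ).trans ?_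
  refine mul_le_mul_of_nonneg_left ?_ (by positivity)
  refine le_trans (Finset.sum_le_sum fun f _ => ?_) (hfar ι)
  exact mul_le_of_le_one_right (Finset.prod_nonneg fun p _ => hr0 _) (hQ.diag_re_le_one f)

end Concentration

/-! ### Spectra of density operators and traces of tensor powers -/

section Spectrum

variable {d : ℕ}

namespace DensityOperator

lemma spec_antitone (A : DensityOperator d) : Antitone A.spec := fun _ _ hij =>
  A.posSemidef.isHermitian.eigenvalues₀_antitone (Fin.cast_le_cast _ |>.2 hij)

lemma exists_perm_eigenvalues (A : DensityOperator d) :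
    ∃ π : Equiv.Perm (Fin d), ∀ i, A.posSemidef.isHermitian.eigenvalues i = A.spec (π i) := by
  refine ⟨(Fintype.equivOfCardEq (Fintype.card_fin _)).symm.trans
    (finCongr (Fintype.card_fin d)), fun i => ?_⟩
  rfl

lemma spec_nonneg (A : DensityOperator d) (i : Fin d) : 0 ≤ A.spec i := by
  obtain ⟨π, hπ⟩ := A.exists_perm_eigenvalues
  have := A.posSemidef.eigenvalues_nonneg (π.symm i)
  rwa [hπ, Equiv.apply_symm_apply] at this

lemma sum_spec (A : DensityOperator d) : ∑ i, A.spec i = 1 := by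
  obtain ⟨π, hπ⟩ := A.exists_perm_eigenvalues
  have h := A.posSemidef.isHermitian.trace_eq_sum_eigenvalues
  rw [A.trace_eq_one] at h
  rw [← Equiv.sum_comp π]
  simp only [← hπ]
  have h' := congrArg Complex.re h
  simpa using h'.symm

/-- Diagonalisation of a density operator with eigenvalues in nonincreasing order. -/
lemma exists_diagonalisation (A : DensityOperator d) :
    ∃ V : Matrix (Fin d) (Fin d) ℂ, Vᴴ * V = 1 ∧
      A.toMatrix = V * Matrix.diagonal (fun i => (A.spec i : ℂ)) * Vᴴ := by
  obtain ⟨π, hπ⟩ := A.exists_perm_eigenvalues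
  have hs := A.posSemidef.isHermitian.spectral_theorem
  rw [Unitary.conjStarAlgAut_apply] at hs
  set U : Matrix (Fin d) (Fin d) ℂ :=
    (A.posSemidef.isHermitian.eigenvectorUnitary).1 with hU
  have hUU : Uᴴ * U = 1 :=
    Unitary.coe_star_mul_self A.posSemidef.isHermitian.eigenvectorUnitary
  set M : Matrix (Fin d) (Fin d) ℂ := Matrix.of fun a b => if π a = b then 1 else 0 with hM
  have hMD : ∀ D : Fin d → ℂ, M * Matrix.diagonal D * Mᴴ = Matrix.diagonal (D ∘ π) := by
    intro D
    ext a b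
    rw [Matrix.mul_apply]
    simp only [Matrix.mul_diagonal, hM, Matrix.of_apply, Matrix.conjTranspose_apply,
      Matrix.diagonal_apply]
    rw [Finset.sum_eq_single (π a)]
    · by_cases h : a = b
      · simp [h]
      · have h' : π b ≠ π a := fun h' => h (π.injective h'.symm)
        simp [h, h']
    · intro c _ hc
      simp [hc.symm]
    · simp
  have hMM : Mᴴ * M = 1 := by
    rw [mul_eq_one_comm]
    have := hMD 1
    simpa using this
  refine ⟨U * M, ?_, ?_⟩
  · rw [Matrix.conjTranspose_mul, Matrix.mul_assoc, ← Matrix.mul_assoc Uᴴ, hUU, Matrix.one_mul,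
      hMM]
  · rw [hs, Matrix.conjTranspose_mul]
    have hd : Matrix.diagonal (RCLike.ofReal ∘ A.posSemidef.isHermitian.eigenvalues) =
        M * Matrix.diagonal (fun i => (A.spec i : ℂ)) * Mᴴ := by
      rw [hMD]
      congr 1
      ext i
      simp [hπ]
    rw [hd]
    simp only [Matrix.mul_assoc]
    rfl

end DensityOperator

variable {ι κ : Type} [Fintype ι] [DecidableEq ι] [Fintype κ] [DecidableEq κ]

/-- Writing A = V D Vᴴ, the tensor power of `V` commutes with `Q` and cancels under the trace,
leaving a diagonal operator times `Q`. -/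
lemma trace_tensorMat_mul (A : DensityOperator d) {Q : Matrix (ι → Fin d) (ι → Fin d) ℂ}
    (hcomm : ∀ T, PermInvariant T → Q * T = T * Q) :
    (tensorMat (fun _ => A.toMatrix) * Q).trace.re =
      ∑ f, (∏ p, A.spec (f p)) * (Q f f).re := by
  obtain ⟨V, hV, hA⟩ := A.exists_diagonalisation
  have hVV : (tensorMat fun _ : ι => V)ᴴ * tensorMat (fun _ => V) = 1 := by
    rw [tensorMat_conjTranspose, tensorMat_mul, hV, tensorMat_one]
  have hdec : tensorMat (fun _ : ι => A.toMatrix) = tensorMat (fun _ => V) *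
      Matrix.diagonal (fun f : ι → Fin d => ∏ p, (A.spec (f p) : ℂ)) *
      (tensorMat fun _ => V)ᴴ := by
    rw [← tensorMat_diagonal (fun i => (A.spec i : ℂ)), tensorMat_conjTranspose, tensorMat_mul,
      tensorMat_mul, ← hA]
  rw [hdec, Matrix.mul_assoc, ← hcomm _ (permInvariant_tensorMat V).conjTranspose,
    Matrix.mul_assoc, Matrix.trace_mul_comm, Matrix.mul_assoc, Matrix.mul_assoc, hVV,
    Matrix.mul_one, Matrix.trace, Complex.re_sum]
  refine Finset.sum_congr rfl fun f _ => ?_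
  rw [Matrix.diag_apply, Matrix.diagonal_mul, ← Complex.ofReal_prod, Complex.re_ofReal_mul]

open scoped MatrixOrder Matrix.Norms.L2Operator in
lemma Matrix.PosSemidef.exists_eq_conjTranspose_mul_self {X : Matrix (Fin d) (Fin d) ℂ}
    (hX : X.PosSemidef) : ∃ B : Matrix (Fin d) (Fin d) ℂ, X = Bᴴ * B :=
  CStarAlgebra.nonneg_iff_eq_star_mul_self.1 hX.nonneg

lemma posSemidef_tensorMat {X : ι → Matrix (Fin d) (Fin d) ℂ} (hX : ∀ p, (X p).PosSemidef) :
    (tensorMat X).PosSemidef := by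
  choose B hB using fun p => (hX p).exists_eq_conjTranspose_mul_self
  have : tensorMat X = (tensorMat B)ᴴ * tensorMat B := by
    rw [tensorMat_conjTranspose, tensorMat_mul]
    congr 1
    exact funext hB
  rw [this]
  exact Matrix.posSemidef_conjTranspose_mul_self _

/-- By cyclicity this is the trace of Q R Qᴴ. -/
lemma trace_mul_projection_nonneg {n : Type*} [Fintype n] [DecidableEq n] {R Q : Matrix n n ℂ}
    (hR : R.PosSemidef) (hQ : IsStarProjection Q) : 0 ≤ (R * Q).trace := by
  have h : (R * Q).trace = (Q * R * Qᴴ).trace := by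
    rw [Matrix.trace_mul_comm (Q * R), ← Matrix.mul_assoc, hQ.conjTranspose_eq, hQ.mul_self_eq,
      Matrix.trace_mul_comm]
  rw [h]
  exact (hR.mul_mul_conjTranspose_same Q).trace_nonneg

end Spectrum

/-! ### Young frames and the spectrum estimate -/

section Frames

variable {d : ℕ} {ι κ : Type} [Fintype ι] [DecidableEq ι] [Fintype κ] [DecidableEq κ]

lemma YoungFrame.card_eq_sum (μ : YoungFrame d) : μ.1.card = ∑ i : Fin d, μ.1.rowLen i := by
  simp only [← content_rowWord, sum_content]
  simp [YoungDiagram.card]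

lemma exists_youngFrame {lam : Fin d → ℕ} (h : Antitone lam) :
    ∃ μ : YoungFrame d, ∀ i : Fin d, μ.1.rowLen i = lam i := by
  let D : YoungDiagram :=
    { cells := (Finset.univ : Finset (Fin d)).biUnion fun i =>
        (Finset.range (lam i)).image fun j => ((i : ℕ), j)
      isLowerSet := by
        intro a b hba ha
        simp only [Finset.coe_biUnion, Set.mem_iUnion, Finset.coe_image, Set.mem_image,
          Finset.mem_coe, Finset.mem_univ, Finset.mem_range, exists_prop, true_and] at ha ⊢
        obtain ⟨i, j, hj, rfl⟩ := ha
        have h1 : b.1 ≤ i := hba.1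
        have h2 : b.2 ≤ j := hba.2
        refine ⟨⟨b.1, h1.trans_lt i.2⟩, b.2, (h2.trans_lt hj).trans_le (h h1), rfl⟩ }
  have hmem : ∀ (i j : ℕ), (i, j) ∈ D ↔ ∃ hi : i < d, j < lam ⟨i, hi⟩ := by
    intro i j
    rw [← YoungDiagram.mem_cells]
    simp only [D, Finset.mem_biUnion, Finset.mem_univ, Finset.mem_image, Finset.mem_range,
      true_and, Prod.mk.injEq]
    constructor
    · rintro ⟨a, b, hb, rfl, rfl⟩
      exact ⟨a.2, hb⟩
    · rintro ⟨hi, hj⟩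
      exact ⟨⟨i, hi⟩, j, hj, rfl, rfl⟩
  refine ⟨⟨D, ?_⟩, fun i => ?_⟩
  · by_contra hlt
    push Not at hlt
    obtain ⟨hd, -⟩ := (hmem d 0).1 (YoungDiagram.mem_iff_lt_colLen.2 hlt)
    exact lt_irrefl d hd
  · refine eq_of_forall_lt_iff fun j => ?_
    rw [← YoungDiagram.mem_iff_lt_rowLen, hmem]
    exact ⟨fun ⟨_, h⟩ => h, fun h => ⟨i.2, h⟩⟩

/-- The projection onto the vectors killed by all relabellings of a family of operators. -/
lemma exists_kernel_projection (N : YoungFrame d → Prop)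
    (G : ∀ μ : YoungFrame d, Matrix (μ.1.cells → Fin d) (μ.1.cells → Fin d) ℂ)
    (hG : ∀ μ T, PermInvariant T → T * G μ = G μ * T) (ι : Type) [Fintype ι] [DecidableEq ι] :
    ∃ Q : Matrix (ι → Fin d) (ι → Fin d) ℂ, IsStarProjection Q ∧
      (∀ T, PermInvariant T → Q * T = T * Q) ∧
      ∀ v, Q *ᵥ v = v ↔ ∀ μ, N μ → ∀ τ : ι ≃ μ.1.cells, G μ *ᵥ (permMat d τ *ᵥ v) = 0 := by
  let S : Submodule ℂ ((ι → Fin d) → ℂ) :=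
    { carrier := {v | ∀ μ, N μ → ∀ τ : ι ≃ μ.1.cells, G μ *ᵥ (permMat d τ *ᵥ v) = 0}
      zero_mem' := by intro μ _ τ; simp
      add_mem' := by
        intro v w hv hw μ hμ τ
        rw [Matrix.mulVec_add, Matrix.mulVec_add, hv μ hμ τ, hw μ hμ τ, add_zero]
      smul_mem' := by
        intro c v hv μ hμ τ
        rw [Matrix.mulVec_smul, Matrix.mulVec_smul, hv μ hμ τ, smul_zero] }
  have hinv : ∀ T, PermInvariant T → ∀ v ∈ S, T *ᵥ v ∈ S := by
    intro T hT v hv μ hμ τ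
    let T' : Matrix (μ.1.cells → Fin d) (μ.1.cells → Fin d) ℂ :=
      Matrix.of fun f g => T (f ∘ τ) (g ∘ τ)
    have hT' : PermInvariant T' := by
      intro σ f g
      have h := hT (τ.trans (σ.trans τ.symm)) (f ∘ τ) (g ∘ τ)
      have hcomp : ∀ f : μ.1.cells → Fin d,
          (f ∘ τ) ∘ (τ.trans (σ.trans τ.symm)) = (f ∘ σ) ∘ τ := fun f => by ext x; simp
      rw [hcomp, hcomp] at h
      exact h
    have hcomm : permMat d τ * T = T' * permMat d τ := by
      ext f g
      rw [permMat_mul_apply, mul_permMat_apply]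
      simp only [T', Matrix.of_apply]
      congr 1
      ext x; simp
    rw [Matrix.mulVec_mulVec v (permMat d τ) T, hcomm, ← Matrix.mulVec_mulVec,
      Matrix.mulVec_mulVec _ (G μ), ← hG μ T' hT', ← Matrix.mulVec_mulVec, hv μ hμ τ,
      Matrix.mulVec_zero]
  obtain ⟨Q, hQ, hmem, hid, -⟩ := exists_isStarProjection S
  refine ⟨Q, hQ, fun T hT => commute_of_invariant hQ hmem hid (hinv T hT)
    (hinv _ hT.conjTranspose), fun v => ⟨fun h => ?_, hid v⟩⟩
  have := hmem v
  rwa [h] at this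

/-- A frame is near `r` when its row lengths are not far. -/
def IsNear (r : Fin d → ℝ) (ε : ℝ) (μ : YoungFrame d) : Prop :=
  ¬ IsFar r ε μ.1.card fun i => μ.1.rowLen i

/-- The vectors killed by all Young symmetrisers with frames near the spectrum carry little of
the tensor power of a density operator. -/
lemma exists_trace_bound (A : DensityOperator d) {ε : ℝ} (hε : 0 < ε)
    (G : ∀ μ : YoungFrame d, Matrix (μ.1.cells → Fin d) (μ.1.cells → Fin d) ℂ)
    (hG : ∀ μ T, PermInvariant T → T * G μ = G μ * T)
    (hkill : ∀ μ v, (∀ σ : Equiv.Perm μ.1.cells, G μ *ᵥ (permMat d σ *ᵥ v) = 0) →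
      youngMat d μ.1 *ᵥ v = 0) :
    ∃ β : ℕ → ℝ, Filter.Tendsto β Filter.atTop (𝓝 0) ∧
      ∀ (ι : Type) [Fintype ι] [DecidableEq ι],
        ∃ Q : Matrix (ι → Fin d) (ι → Fin d) ℂ, IsStarProjection Q ∧
          (∀ v, Q *ᵥ v = v ↔ ∀ μ, IsNear A.spec ε μ → ∀ τ : ι ≃ μ.1.cells,
            G μ *ᵥ (permMat d τ *ᵥ v) = 0) ∧
          (tensorMat (fun _ => A.toMatrix) * Q).trace.re ≤ β (Fintype.card ι) := by
  obtain ⟨β, hβ, hbound⟩ := exists_diag_bound A.spec_antitone A.spec_nonneg A.sum_spec hε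
  refine ⟨β, hβ, fun ι _ _ => ?_⟩
  obtain ⟨Q, hQ, hcomm, hker⟩ := exists_kernel_projection (IsNear A.spec ε) G hG ι
  refine ⟨Q, hQ, hker, ?_⟩
  rw [trace_tensorMat_mul A hcomm]
  refine hbound ι Q hQ hcomm fun lam y hy0 hQy hy hanti => ?_
  -- A weight that is not far comes from a near frame, and some relabelled symmetriser of that frame
  -- does not kill `y`, although `y` lies in the joint kernel.
  by_contra hfar
  obtain ⟨μ, hμ⟩ := exists_youngFrame hanti
  have hlam : lam = fun i : Fin d => μ.1.rowLen i := funext fun i => (hμ i).symm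
  obtain ⟨f, hf⟩ := Function.ne_iff.1 hy0
  have hcard : Fintype.card ι = μ.1.card := by
    rw [μ.card_eq_sum, ← sum_content f, hy.weight f hf, hlam]
  have hnear : IsNear A.spec ε μ := by
    rw [IsNear, ← hcard, ← hlam]
    exact hfar
  have e : ι ≃ μ.1.cells := Fintype.equivOfCardEq (by simpa [YoungDiagram.card] using hcard)
  rw [hlam] at hy
  obtain ⟨τ, hτ⟩ := hy.exists_youngMat_ne_zero hy0 e
  refine hτ (hkill μ _ fun σ => ?_)
  rw [Matrix.mulVec_mulVec _ (permMat d σ), permMat_mul]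
  exact (hker y).1 hQy μ hnear _

end Frames

/-! ### The Cartan component of a tensor product -/

section Cartan

variable {d : ℕ} {ι κ : Type} [Fintype ι] [DecidableEq ι] [Fintype κ] [DecidableEq κ]

/-- The tensor product of two vectors. -/
def tensorVec (y : (ι → Fin d) → ℂ) (z : (κ → Fin d) → ℂ) (f : ι ⊕ κ → Fin d) : ℂ :=
  y (f ∘ Sum.inl) * z (f ∘ Sum.inr)

lemma sumKron_mulVec_tensorVec {ι' κ' : Type} [Fintype ι'] [DecidableEq ι'] [Fintype κ']
    [DecidableEq κ'] (M : Matrix (ι' → Fin d) (ι → Fin d) ℂ)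
    (N : Matrix (κ' → Fin d) (κ → Fin d) ℂ) (y : (ι → Fin d) → ℂ) (z : (κ → Fin d) → ℂ) :
    sumKron M N *ᵥ tensorVec y z = tensorVec (M *ᵥ y) (N *ᵥ z) := by
  ext f
  simp only [sumKron, tensorVec, Matrix.mulVec, dotProduct, Matrix.of_apply, sum_words_sum,
    Sum.elim_comp_inl, Sum.elim_comp_inr, Finset.sum_mul_sum]
  exact Finset.sum_congr rfl fun _ _ => Finset.sum_congr rfl fun _ _ => by ring

lemma content_sum (f : ι ⊕ κ → Fin d) (i : Fin d) :
    content f i = content (f ∘ Sum.inl) i + content (f ∘ Sum.inr) i := by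
  simp only [content, Finset.card_filter, Fintype.sum_sum_type, Function.comp_apply]

lemma IsHighestWeight.tensorVec {lam lam' : Fin d → ℕ} {y : (ι → Fin d) → ℂ}
    {z : (κ → Fin d) → ℂ} (hy : IsHighestWeight lam y) (hz : IsHighestWeight lam' z) :
    IsHighestWeight (fun i => lam i + lam' i) (tensorVec y z) where
  weight f hf := by
    ext i
    rw [content_sum, hy.weight _ (left_ne_zero_of_mul hf), hz.weight _ (right_ne_zero_of_mul hf)]
  fixed U hU := by
    rw [tensorMat_sum, sumKron_mulVec_tensorVec, hy.fixed U hU, hz.fixed U hU]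

lemma youngMat_conjTranspose_mulVec_rowWord (μ : YoungFrame d) :
    (youngMat d μ.1)ᴴ *ᵥ Pi.single (rowWord μ) 1 = (rowOrder μ.1 : ℂ) • specht μ := by
  rw [youngMat_conjTranspose, ← Matrix.mulVec_mulVec, rowMat_mulVec_rowWord, Matrix.mulVec_smul,
    specht]

/-- The sum of two highest weights occurs in the tensor product. -/
lemma littlewoodRichardson_add_ne_zero {μ ν lam : YoungFrame d}
    (h : ∀ i : Fin d, lam.1.rowLen i = μ.1.rowLen i + ν.1.rowLen i) :
    littlewoodRichardson μ ν lam ≠ 0 := by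
  intro h0
  have hcard : Fintype.card (μ.1.cells ⊕ ν.1.cells) = Fintype.card lam.1.cells := by
    rw [Fintype.card_sum, Fintype.card_coe, Fintype.card_coe, Fintype.card_coe]
    change μ.1.card + ν.1.card = lam.1.card
    simp only [YoungFrame.card_eq_sum, h, Finset.sum_add_distrib]
  have e : μ.1.cells ⊕ ν.1.cells ≃ lam.1.cells := Fintype.equivOfCardEq hcard
  have hy := (isHighestWeight_specht μ).tensorVec (isHighestWeight_specht ν)
  have hlam : (fun i : Fin d => μ.1.rowLen i + ν.1.rowLen i) =
      fun i : Fin d => lam.1.rowLen i := funext fun i => (h i).symm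
  rw [hlam] at hy
  have hy0 : tensorVec (specht μ) (specht ν) ≠ 0 := fun hzero => by
    have := congrFun hzero (Sum.elim (rowWord μ) (rowWord ν))
    simp [tensorVec, specht_rowWord] at this
  obtain ⟨τ, hτ⟩ := hy.exists_youngMat_ne_zero hy0 e
  refine hτ (youngMat_mulVec_eq_zero lam.1 fun σ => ?_)
  rw [Matrix.mulVec_mulVec _ (permMat d σ), permMat_mul]
  -- Taking adjoints places the symmetrisers of μ and ν on the right, where they send the row words
  -- to multiples of the Specht vectors. So the adjoint symmetriser of λ kills every relabelling of
  -- their tensor product.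
  have hz := congrArg Matrix.conjTranspose
    (sumKron_youngMat_mul_eq_zero h0 (τ.trans σ).symm)
  rw [Matrix.conjTranspose_mul, Matrix.conjTranspose_mul, Matrix.conjTranspose_zero,
    permMat_conjTranspose, Equiv.symm_symm, sumKron_conjTranspose] at hz
  have hv := congrArg (fun M => M *ᵥ tensorVec (Pi.single (rowWord μ) (1 : ℂ))
    (Pi.single (rowWord ν) (1 : ℂ))) hz
  simp only [← Matrix.mulVec_mulVec, sumKron_mulVec_tensorVec,
    youngMat_conjTranspose_mulVec_rowWord, Matrix.zero_mulVec] at hv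
  have hsmul : tensorVec ((rowOrder μ.1 : ℂ) • specht μ) ((rowOrder ν.1 : ℂ) • specht ν) =
      ((rowOrder μ.1 : ℂ) * rowOrder ν.1) • tensorVec (specht μ) (specht ν) := by
    ext f
    simp only [tensorVec, Pi.smul_apply, smul_eq_mul]
    ring
  rw [hsmul, Matrix.mulVec_smul, Matrix.mulVec_smul, smul_eq_zero] at hv
  exact hv.resolve_left (mul_ne_zero (rowOrder_ne_zero _) (rowOrder_ne_zero _))

end Cartan

/-! ### Trace inequality for products of two states -/

section Mixture

variable {d : ℕ} {ι κ ω : Type} [Fintype ι] [DecidableEq ι] [Fintype κ] [DecidableEq κ]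
  [Fintype ω] [DecidableEq ω]

lemma sumKron_permMat {ι' κ' : Type} [Fintype ι'] [DecidableEq ι'] [Fintype κ']
    [DecidableEq κ'] (τ : ι ≃ ι') (τ' : κ ≃ κ') :
    sumKron (permMat d τ) (permMat d τ') = permMat d (Equiv.sumCongr τ τ') := by
  ext f g
  simp only [sumKron, permMat, Matrix.of_apply]
  have : f ∘ (Equiv.sumCongr τ τ') = g ↔
      (f ∘ Sum.inl) ∘ τ = g ∘ Sum.inl ∧ (f ∘ Sum.inr) ∘ τ' = g ∘ Sum.inr := by
    constructor
    · rintro rfl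
      exact ⟨rfl, rfl⟩
    · rintro ⟨h1, h2⟩
      ext (x | x)
      · exact congrArg Fin.val (congrFun h1 x)
      · exact congrArg Fin.val (congrFun h2 x)
  by_cases h1 : (f ∘ Sum.inl) ∘ τ = g ∘ Sum.inl
  · by_cases h2 : (f ∘ Sum.inr) ∘ τ' = g ∘ Sum.inr
    · rw [if_pos h1, if_pos h2, if_pos (this.2 ⟨h1, h2⟩), one_mul]
    · rw [if_neg h2, if_neg fun h => h2 (this.1 h).2, mul_zero]
  · rw [if_neg h1, if_neg fun h => h1 (this.1 h).1, zero_mul]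

lemma sumKron_mulVec_apply_right {ι' κ' : Type} [Fintype ι'] [DecidableEq ι'] [Fintype κ']
    [DecidableEq κ'] (M : Matrix (ι → Fin d) (ι' → Fin d) ℂ)
    (N : Matrix (κ → Fin d) (κ' → Fin d) ℂ) (x : (ι' ⊕ κ' → Fin d) → ℂ) (f : ι → Fin d)
    (g : κ → Fin d) : (sumKron M N *ᵥ x) (Sum.elim f g) =
      (N *ᵥ fun g' => (M *ᵥ fun f' => x (Sum.elim f' g')) f) g := by
  rw [sumKron_mulVec_apply]
  simp only [Matrix.mulVec, dotProduct, Finset.mul_sum]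
  rw [Finset.sum_comm]
  exact Finset.sum_congr rfl fun _ _ => Finset.sum_congr rfl fun _ _ => by ring

/-- One tensor factor is treated at a time: with the other index fixed, the slices of the partly
transformed vector lie in the joint kernel that `P`, respectively `P'`, annihilates. -/
lemma sumKron_mulVec_eq_zero_of_slices {S S' : YoungFrame d → Prop}
    {P : Matrix (ι → Fin d) (ι → Fin d) ℂ} {P' : Matrix (κ → Fin d) (κ → Fin d) ℂ}
    (hP : ∀ v, (∀ μ, S μ → ∀ τ : ι ≃ μ.1.cells, youngMat d μ.1 *ᵥ (permMat d τ *ᵥ v) = 0) →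
      P *ᵥ v = 0)
    (hP' : ∀ v, (∀ μ, S' μ → ∀ τ : κ ≃ μ.1.cells, youngMat d μ.1 *ᵥ (permMat d τ *ᵥ v) = 0) →
      P' *ᵥ v = 0)
    {x : (ι ⊕ κ → Fin d) → ℂ}
    (hx : ∀ μ ν, S μ → S' ν → ∀ (τ : ι ≃ μ.1.cells) (τ' : κ ≃ ν.1.cells),
      sumKron (youngMat d μ.1 * permMat d τ) (youngMat d ν.1 * permMat d τ') *ᵥ x = 0) :
    sumKron P P' *ᵥ x = 0 := by
  have h1 : ∀ ν, S' ν → ∀ τ' : κ ≃ ν.1.cells,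
      sumKron P (youngMat d ν.1 * permMat d τ') *ᵥ x = 0 := by
    intro ν hν τ'
    ext f
    rw [← Sum.elim_comp_inl_inr f, sumKron_mulVec_apply, hP, Pi.zero_apply, Pi.zero_apply]
    intro μ hμ τ
    ext g
    rw [Matrix.mulVec_mulVec, ← sumKron_mulVec_apply, hx μ ν hμ hν τ τ', Pi.zero_apply,
      Pi.zero_apply]
  ext f
  rw [← Sum.elim_comp_inl_inr f, sumKron_mulVec_apply_right, hP', Pi.zero_apply, Pi.zero_apply]
  intro ν hν τ'
  ext g
  rw [Matrix.mulVec_mulVec, ← sumKron_mulVec_apply_right, h1 ν hν τ', Pi.zero_apply,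
    Pi.zero_apply]

lemma isStarProjection_sumKron {P : Matrix (ι → Fin d) (ι → Fin d) ℂ}
    {P' : Matrix (κ → Fin d) (κ → Fin d) ℂ} (hP : IsStarProjection P)
    (hP' : IsStarProjection P') : IsStarProjection (sumKron P P') := by
  refine ⟨?_, ?_⟩
  · change sumKron P P' * sumKron P P' = sumKron P P'
    rw [sumKron_mul, hP.mul_self_eq, hP'.mul_self_eq]
  · change (sumKron P P')ᴴ = sumKron P P'
    rw [sumKron_conjTranspose, hP.conjTranspose_eq, hP'.conjTranspose_eq]

lemma IsStarProjection.transport {P : Matrix (κ → Fin d) (κ → Fin d) ℂ} (hP : IsStarProjection P)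
    (e : ω ≃ κ) : IsStarProjection (permMat d e.symm * P * permMat d e) := by
  have hee : permMat d e * permMat d e.symm = 1 := permMat_symm_mul_self e.symm
  refine ⟨?_, ?_⟩
  · change permMat d e.symm * P * permMat d e * (permMat d e.symm * P * permMat d e) = _
    calc permMat d e.symm * P * permMat d e * (permMat d e.symm * P * permMat d e)
        = permMat d e.symm * P * (permMat d e * permMat d e.symm) * P * permMat d e := by
          simp only [Matrix.mul_assoc]
      _ = permMat d e.symm * (P * P) * permMat d e := by
          rw [hee, Matrix.mul_one]; simp only [Matrix.mul_assoc]
      _ = _ := by rw [hP.mul_self_eq]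
  · change (permMat d e.symm * P * permMat d e)ᴴ = _
    rw [Matrix.conjTranspose_mul, Matrix.conjTranspose_mul, permMat_conjTranspose,
      permMat_conjTranspose, hP.conjTranspose_eq, Equiv.symm_symm, Matrix.mul_assoc]

/-- The tensor power of a mixture expands over the assignments of the factors to the two
states. -/
lemma tensorMat_mixture (w : Fin 2 → ℂ) (M : Fin 2 → Matrix (Fin d) (Fin d) ℂ) :
    tensorMat (fun _ : ω => ∑ b, w b • M b) =
      ∑ s : ω → Fin 2, (∏ q, w (s q)) • tensorMat fun q => M (s q) := by
  ext f g
  simp only [tensorMat, Matrix.of_apply, Matrix.sum_apply, Matrix.smul_apply, smul_eq_mul,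
    ← Finset.prod_mul_distrib]
  rw [Finset.prod_univ_sum, Fintype.piFinset_univ]

/-- If all Littlewood–Richardson coefficients of near frames vanish, the projection `QC` carries
a product of the complementary weights of `QA` and `QB`. -/
lemma le_trace_of_littlewoodRichardson_eq_zero {A B : DensityOperator d}
    {SA SB SC : YoungFrame d → Prop}
    (hLR : ∀ μ ν lam, SA μ → SB ν → SC lam → littlewoodRichardson μ ν lam = 0)
    (e : ω ≃ ι ⊕ κ) {X : ω → Matrix (Fin d) (Fin d) ℂ}
    (hXA : ∀ p, X (e.symm (Sum.inl p)) = A.toMatrix)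
    (hXB : ∀ p, X (e.symm (Sum.inr p)) = B.toMatrix)
    {QA : Matrix (ι → Fin d) (ι → Fin d) ℂ} {QB : Matrix (κ → Fin d) (κ → Fin d) ℂ}
    {QC : Matrix (ω → Fin d) (ω → Fin d) ℂ} (hQA : IsStarProjection QA)
    (hQB : IsStarProjection QB) (hQC : IsStarProjection QC)
    (hA : ∀ v, QA *ᵥ v = v ↔ ∀ μ, SA μ → ∀ τ : ι ≃ μ.1.cells,
      youngMat d μ.1 *ᵥ (permMat d τ *ᵥ v) = 0)
    (hB : ∀ v, QB *ᵥ v = v ↔ ∀ μ, SB μ → ∀ τ : κ ≃ μ.1.cells,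
      youngMat d μ.1 *ᵥ (permMat d τ *ᵥ v) = 0)
    (hC : ∀ v, QC *ᵥ v = v ↔ ∀ μ, SC μ → ∀ τ : ω ≃ μ.1.cells,
      (youngMat d μ.1)ᴴ *ᵥ (permMat d τ *ᵥ v) = 0) :
    (1 - (tensorMat (fun _ => A.toMatrix) * QA).trace.re) *
      (1 - (tensorMat (fun _ => B.toMatrix) * QB).trace.re) ≤ (tensorMat X * QC).trace.re := by
  -- `R` projects onto the part not killed by near symmetrisers of A and B. Its range lies in that
  -- of `QC`, because by `hzero` every near adjoint symmetriser for C kills it.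
  set R := permMat d e.symm * sumKron (1 - QA) (1 - QB) * permMat d e with hR
  have hRproj : IsStarProjection R := (isStarProjection_sumKron hQA.one_sub hQB.one_sub).transport e
  have hzero : ∀ lam, SC lam → ∀ τ : ω ≃ lam.1.cells,
      (youngMat d lam.1)ᴴ * permMat d τ * permMat d e.symm * sumKron (1 - QA) (1 - QB) = 0 := by
    intro lam hlam τ
    have h1 : sumKron (1 - QA) (1 - QB) * (permMat d (τ.symm.trans e) * youngMat d lam.1) = 0 := by
      refine Matrix.mulVec_injective (funext fun v => ?_)
      rw [Matrix.zero_mulVec, ← Matrix.mulVec_mulVec]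
      refine sumKron_mulVec_eq_zero_of_slices (S := SA) (S' := SB) ?_ ?_ ?_
      · intro v hv
        rw [Matrix.sub_mulVec, Matrix.one_mulVec, (hA v).2 hv, sub_self]
      · intro v hv
        rw [Matrix.sub_mulVec, Matrix.one_mulVec, (hB v).2 hv, sub_self]
      · intro μ ν hμ hν τ₁ τ₂
        rw [← sumKron_mul, sumKron_permMat, Matrix.mulVec_mulVec, ← Matrix.mul_assoc,
          Matrix.mul_assoc _ (permMat d (Equiv.sumCongr τ₁ τ₂)), permMat_mul,
          sumKron_youngMat_mul_eq_zero (hLR μ ν lam hμ hν hlam), Matrix.zero_mulVec]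
    have h2 := congrArg Matrix.conjTranspose h1
    rw [Matrix.conjTranspose_mul, Matrix.conjTranspose_mul, Matrix.conjTranspose_zero,
      sumKron_conjTranspose, hQA.one_sub.conjTranspose_eq, hQB.one_sub.conjTranspose_eq,
      permMat_conjTranspose] at h2
    have h3 : permMat d τ * permMat d e.symm = permMat d (τ.symm.trans e).symm := by
      rw [permMat_mul]
      rfl
    rw [Matrix.mul_assoc _ (permMat d τ), h3, h2]
  have hQR : QC * R = R := by
    refine Matrix.mulVec_injective (funext fun v => ?_)
    rw [← Matrix.mulVec_mulVec]
    refine (hC _).2 fun lam hlam τ => ?_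
    rw [Matrix.mulVec_mulVec, Matrix.mulVec_mulVec, hR]
    have : (youngMat d lam.1)ᴴ * permMat d τ * (permMat d e.symm *
        sumKron (1 - QA) (1 - QB) * permMat d e) = 0 := by
      simp only [← Matrix.mul_assoc, hzero lam hlam τ, Matrix.zero_mul]
    rw [this, Matrix.zero_mulVec]
  have hXpos : (tensorMat X).PosSemidef := by
    refine posSemidef_tensorMat fun q => ?_
    obtain ⟨p, rfl⟩ := e.symm.surjective q
    rcases p with p | p
    · rw [hXA]; exact A.posSemidef
    · rw [hXB]; exact B.posSemidef
  have hdiff := trace_mul_projection_nonneg hXpos (hQC.sub_of_mul_eq hRproj hQR)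
  rw [Matrix.mul_sub, Matrix.trace_sub, sub_nonneg] at hdiff
  have hRtr : (tensorMat X * R).trace =
      (1 - (tensorMat (fun _ => A.toMatrix) * QA).trace) *
        (1 - (tensorMat (fun _ => B.toMatrix) * QB).trace) := by
    have hconj : permMat d e * tensorMat X * permMat d e.symm =
        sumKron (tensorMat fun _ => A.toMatrix) (tensorMat fun _ => B.toMatrix) := by
      rw [permMat_mul_tensorMat, Matrix.mul_assoc, show permMat d e * permMat d e.symm = 1 from
        permMat_symm_mul_self e.symm, Matrix.mul_one, tensorMat_sum]
      simp only [hXA, hXB]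
    have hone : ∀ (A : DensityOperator d) (η : Type) [Fintype η] [DecidableEq η]
        (Q : Matrix (η → Fin d) (η → Fin d) ℂ),
        (tensorMat (fun _ => A.toMatrix) * (1 - Q)).trace =
          1 - (tensorMat (fun _ => A.toMatrix) * Q).trace := by
      intro A η _ _ Q
      rw [Matrix.mul_sub, Matrix.mul_one, Matrix.trace_sub, trace_tensorMat, A.trace_eq_one]
      simp
    rw [hR, ← Matrix.mul_assoc, Matrix.trace_mul_comm, ← Matrix.mul_assoc, ← Matrix.mul_assoc,
      hconj, sumKron_mul, trace_sumKron, hone, hone]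
  -- Nonnegativity in ℂ includes reality, so the real part of the product of traces is the product
  -- of the real parts.
  have ha := trace_mul_projection_nonneg (posSemidef_tensorMat fun _ : ι => A.posSemidef) hQA
  have hb := trace_mul_projection_nonneg (posSemidef_tensorMat fun _ : κ => B.posSemidef) hQB
  rw [hRtr] at hdiff
  have hre := (Complex.le_def.1 hdiff).1
  have ha' := (Complex.le_def.1 ha).2
  have hb' := (Complex.le_def.1 hb).2
  rw [Complex.mul_re] at hre
  simp only [Complex.sub_re, Complex.one_re, Complex.sub_im, Complex.one_im, ← ha', ← hb',
    Complex.zero_im, sub_self, mul_zero, sub_zero] at hre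
  exact hre

end Mixture

/-! ### Existence of frames near the spectra, and limits -/

section Existence

variable {d : ℕ}

/-- For a proper mixture there are frames near the three spectra with nonvanishing
Littlewood–Richardson coefficient. -/
lemma exists_near_littlewoodRichardson_ne_zero (p : Set.Icc (0 : ℝ) 1) (hp0 : 0 < (p : ℝ))
    (hp1 : (p : ℝ) < 1) (A B : DensityOperator d) {ε : ℝ} (hε : 0 < ε) :
    ∃ μ ν lam : YoungFrame d, IsNear A.spec ε μ ∧ IsNear B.spec ε ν ∧
      IsNear (DensityOperator.mix p A B).spec ε lam ∧ littlewoodRichardson μ ν lam ≠ 0 := by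
  classical
  by_contra hno
  have hLR : ∀ μ ν lam, IsNear A.spec ε μ → IsNear B.spec ε ν →
      IsNear (DensityOperator.mix p A B).spec ε lam → littlewoodRichardson μ ν lam = 0 := by
    intro μ ν lam h1 h2 h3
    by_contra h4
    exact hno ⟨μ, ν, lam, h1, h2, h3, h4⟩
  have hY : ∀ (μ : YoungFrame d) T, PermInvariant T → T * youngMat d μ.1 = youngMat d μ.1 * T :=
    fun μ T hT => hT.mul_youngMat
  have hY' : ∀ (μ : YoungFrame d) T, PermInvariant T →
      T * (youngMat d μ.1)ᴴ = (youngMat d μ.1)ᴴ * T := fun μ T hT => hT.mul_youngMat_conjTranspose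
  have hkill : ∀ (μ : YoungFrame d) v, (∀ σ : Equiv.Perm μ.1.cells,
      youngMat d μ.1 *ᵥ (permMat d σ *ᵥ v) = 0) → youngMat d μ.1 *ᵥ v = 0 := fun μ v h => by
    have := h 1
    rwa [permMat_one, Matrix.one_mulVec] at this
  obtain ⟨βA, hβA, hA⟩ := exists_trace_bound A hε (fun μ => youngMat d μ.1) hY hkill
  obtain ⟨βB, hβB, hB⟩ := exists_trace_bound B hε (fun μ => youngMat d μ.1) hY hkill
  -- For C the adjoint symmetrisers are used, since they appear on the left when the vanishing
  -- identity for λ is conjugated.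
  obtain ⟨βC, hβC, hC⟩ := exists_trace_bound (DensityOperator.mix p A B) hε
    (fun μ => (youngMat d μ.1)ᴴ) hY' fun μ v h => youngMat_mulVec_eq_zero μ.1 h
  set w : Fin 2 → ℝ := ![(p : ℝ), 1 - p] with hw
  have hw0 : ∀ b, 0 ≤ w b := fun b => by
    fin_cases b
    · exact hp0.le
    · simpa [hw] using hp1.le
  have hw1 : ∑ b, w b = 1 := by simp [hw]
  have hwpos : ∀ b, 0 < w b := fun b => by
    fin_cases b
    · exact hp0
    · simpa [hw] using hp1
  -- With this margin an assignment that is not far uses each state more than η k times, which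
  -- forces both counts above `m₀`.
  set η : ℝ := min (w 0) (w 1) / 2 with hη
  have hηpos : 0 < η := half_pos (lt_min (hwpos 0) (hwpos 1))
  have hηw : ∀ b, η ≤ w b - η := fun b => by
    have : min (w 0) (w 1) ≤ w b := by
      fin_cases b
      · exact min_le_left _ _
      · exact min_le_right _ _
    linarith
  obtain ⟨βS, hβS, hS⟩ := exists_far_bound hw0 hw1 hηpos
  have hβS0 : Filter.Tendsto βS Filter.atTop (𝓝 0) := by simpa using hβS 0
  obtain ⟨m₀, hm₀⟩ := Filter.eventually_atTop.1
    ((hβA.eventually (gt_mem_nhds (by norm_num : (0 : ℝ) < 1 / 4))).and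
      (hβB.eventually (gt_mem_nhds (by norm_num : (0 : ℝ) < 1 / 4))))
  have hlarge : ∀ᶠ k : ℕ in Filter.atTop, (m₀ : ℝ) ≤ η * k :=
    (tendsto_natCast_atTop_atTop.const_mul_atTop hηpos).eventually_ge_atTop _
  obtain ⟨k, ⟨hkC, hkS⟩, hkm⟩ := (((hβC.eventually
    (gt_mem_nhds (by norm_num : (0 : ℝ) < 1 / 4))).and (hβS0.eventually
    (gt_mem_nhds (by norm_num : (0 : ℝ) < 1 / 2)))).and hlarge).exists
  obtain ⟨QC, hQC, hkerC, htrC⟩ := hC (Fin k)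
  have hfar := hS (Fin k)
  simp only [Fintype.card_fin] at htrC hfar
  set M : Fin 2 → Matrix (Fin d) (Fin d) ℂ := ![A.toMatrix, B.toMatrix] with hM
  have hMpos : ∀ b, (M b).PosSemidef := fun b => by
    fin_cases b
    · exact A.posSemidef
    · exact B.posSemidef
  have hmix : (DensityOperator.mix p A B).toMatrix = ∑ b, (w b : ℂ) • M b := by
    rw [Fin.sum_univ_two]
    ext i j
    simp [DensityOperator.mix, hw, hM]
  have hexp : (tensorMat (fun _ : Fin k => (DensityOperator.mix p A B).toMatrix) * QC).trace.re =
      ∑ s : Fin k → Fin 2, (∏ q, w (s q)) * (tensorMat (fun q => M (s q)) * QC).trace.re := by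
    rw [hmix, tensorMat_mixture (fun b => (w b : ℂ)) M, Finset.sum_mul, Matrix.trace_sum,
      Complex.re_sum]
    refine Finset.sum_congr rfl fun s _ => ?_
    rw [Matrix.smul_mul, Matrix.trace_smul, smul_eq_mul, ← Complex.ofReal_prod,
      Complex.re_ofReal_mul]
  -- Both complementary weights are at least 3/4, whence 9/16.
  have hterm : ∀ s : Fin k → Fin 2, ¬ IsFar w η k (content s) →
      9 / 16 ≤ (tensorMat (fun q => M (s q)) * QC).trace.re := by
    intro s hs
    have hcount : ∀ b, m₀ ≤ content s b := by
      intro b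
      have h1 : ¬ η * k ≤ |(content s b : ℝ) - k * w b| := fun h => hs ⟨b, h⟩
      rw [not_le, abs_lt] at h1
      have h2 : η * k ≤ (w b - η) * k := mul_le_mul_of_nonneg_right (hηw b) (Nat.cast_nonneg k)
      have h3 : (m₀ : ℝ) ≤ content s b := by linarith [h1.1]
      exact_mod_cast h3
    have hcardA : Fintype.card {q // s q = 0} = content s 0 := Fintype.card_subtype _
    have hcardB : Fintype.card {q // ¬ s q = 0} = content s 1 := by
      rw [Fintype.card_subtype, content]
      congr 1
      ext q
      simp only [Finset.mem_filter, Finset.mem_univ, true_and]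
      omega
    obtain ⟨QA, hQA, hkerA, htrA⟩ := hA {q // s q = 0}
    obtain ⟨QB, hQB, hkerB, htrB⟩ := hB {q // ¬ s q = 0}
    rw [hcardA] at htrA
    rw [hcardB] at htrB
    have hle := le_trace_of_littlewoodRichardson_eq_zero (A := A) (B := B) hLR
      (Equiv.sumCompl fun q => s q = 0).symm (X := fun q => M (s q))
      (fun q => by
        have : s q.1 = 0 := q.2
        simp [hM, this])
      (fun q => by
        have : s q.1 = 1 := by have := q.2; omega
        simp [hM, this])
      hQA hQB hQC hkerA hkerB hkerC
    have h1 := (hm₀ _ (hcount 0)).1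
    have h2 := (hm₀ _ (hcount 1)).2
    refine le_trans ?_ hle
    have h3 : (3 / 4 : ℝ) ≤ 1 - (tensorMat (fun _ => A.toMatrix) * QA).trace.re := by linarith
    have h4 : (3 / 4 : ℝ) ≤ 1 - (tensorMat (fun _ => B.toMatrix) * QB).trace.re := by linarith
    nlinarith
  have hw' : ∀ s : Fin k → Fin 2, 0 ≤ ∏ q, w (s q) := fun s =>
    Finset.prod_nonneg fun q _ => hw0 _
  have htotal : ∑ s : Fin k → Fin 2, ∏ q, w (s q) = 1 := by
    rw [← Fintype.piFinset_univ, ← Finset.prod_univ_sum (fun _ => Finset.univ) (fun _ b => w b)]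
    simp [hw1]
  rw [← Finset.sum_filter_add_sum_filter_not _ fun s => IsFar w η k (content s)] at htotal
  have hnear : 1 / 2 ≤ ∑ s : Fin k → Fin 2 with ¬ IsFar w η k (content s), ∏ q, w (s q) := by
    linarith
  have hlower : 9 / 16 * ∑ s : Fin k → Fin 2 with ¬ IsFar w η k (content s), ∏ q, w (s q) ≤
      ∑ s : Fin k → Fin 2, (∏ q, w (s q)) * (tensorMat (fun q => M (s q)) * QC).trace.re := by
    rw [Finset.mul_sum]
    refine le_trans (Finset.sum_le_sum fun s hs => ?_)
      (Finset.sum_le_sum_of_subset_of_nonneg (Finset.subset_univ _) fun s _ _ =>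
        mul_nonneg (hw' s) (Complex.le_def.1
          (trace_mul_projection_nonneg (posSemidef_tensorMat fun q => hMpos (s q)) hQC)).1)
    rw [mul_comm]
    exact mul_le_mul_of_nonneg_left (hterm s (Finset.mem_filter.1 hs).2) (hw' s)
  -- Typical assignments have total probability at least 1/2, so the trace is at least 9/32, against
  -- the upper bound 1/4.
  linarith

/-- The far condition is a non-strict inequality, so for an empty frame it holds at every
coordinate. A near frame therefore has nonzero size as soon as a coordinate exists, and dividing by
it is legitimate. -/
lemma IsNear.abs_sub_lt {r : Fin d → ℝ} {ε : ℝ} {μ : YoungFrame d} (h : IsNear r ε μ)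
    (i : Fin d) : |μ.normalised i - r i| < ε := by
  have h1 : ¬ ε * μ.1.card ≤ |(μ.1.rowLen i : ℝ) - μ.1.card * r i| := fun h' => h ⟨i, h'⟩
  rw [not_le] at h1
  have hpos : (0 : ℝ) < μ.1.card := by
    rcases Nat.eq_zero_or_pos μ.1.card with h0 | h0
    · rw [h0] at h1
      simp only [Nat.cast_zero, mul_zero] at h1
      exact absurd h1 (abs_nonneg _).not_gt
    · exact_mod_cast h0
  have h2 : μ.normalised i - r i = ((μ.1.rowLen i : ℝ) - μ.1.card * r i) / μ.1.card := by
    rw [YoungFrame.normalised]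
    field_simp
  rwa [h2, abs_div, abs_of_pos hpos, div_lt_iff₀ hpos]

lemma tendsto_normalised_of_isNear {r : Fin d → ℝ} {μ : ℕ → YoungFrame d}
    (h : ∀ j : ℕ, IsNear r (1 / ((j : ℝ) + 1)) (μ j)) :
    Filter.Tendsto (fun j => (μ j).normalised) Filter.atTop (𝓝 r) := by
  rw [tendsto_pi_nhds]
  intro i
  rw [tendsto_iff_dist_tendsto_zero]
  refine squeeze_zero (fun _ => dist_nonneg) (fun j => ?_)
    (tendsto_one_div_add_atTop_nhds_zero_nat (𝕜 := ℝ))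
  exact ((h j).abs_sub_lt i).le

/-- Frames whose row lengths grow proportionally to a probability vector. -/
lemma tendsto_normalised {r : Fin d → ℝ} (hr1 : ∑ i, r i = 1) {μ : ℕ → YoungFrame d}
    {N : ℕ → ℝ} (hN : ∀ j, 0 < N j)
    (h : ∀ i : Fin d, Filter.Tendsto (fun j => ((μ j).1.rowLen i : ℝ) / N j) Filter.atTop
      (𝓝 (r i))) :
    Filter.Tendsto (fun j => (μ j).normalised) Filter.atTop (𝓝 r) := by
  rw [tendsto_pi_nhds]
  intro i
  have hsum : Filter.Tendsto (fun j => ((μ j).1.card : ℝ) / N j) Filter.atTop (𝓝 1) := by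
    have := tendsto_finsetSum Finset.univ fun i _ => h i
    rw [hr1] at this
    refine this.congr fun j => ?_
    rw [YoungFrame.card_eq_sum, Nat.cast_sum, Finset.sum_div]
  have hdiv := (h i).div hsum one_ne_zero
  rw [div_one] at hdiv
  refine hdiv.congr fun j => ?_
  rw [Pi.div_apply, YoungFrame.normalised, div_div_div_cancel_right₀ (hN j).ne']

/-- Approximation of spectra by frames and their sums. -/
lemma exists_cartan_sequences (A B : DensityOperator d) {c : Fin d → ℝ} (hc : ∑ i, c i = 1)
    {t u : ℝ} {M N : ℕ → ℝ}
    (hM0 : ∀ j, 0 < M j) (hN0 : ∀ j, 0 < N j) (hM : Filter.Tendsto M Filter.atTop Filter.atTop)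
    (hN : Filter.Tendsto N Filter.atTop Filter.atTop)
    (ht : Filter.Tendsto (fun j => M j / (M j + N j)) Filter.atTop (𝓝 t))
    (hu : Filter.Tendsto (fun j => N j / (M j + N j)) Filter.atTop (𝓝 u))
    (hcA : ∀ i, c i = A.spec i * t + B.spec i * u) :
    ∃ μ ν lam : ℕ → YoungFrame d,
      (∀ j, littlewoodRichardson (μ j) (ν j) (lam j) ≠ 0) ∧
      Filter.Tendsto (fun j => (μ j).normalised) Filter.atTop (𝓝 A.spec) ∧
      Filter.Tendsto (fun j => (ν j).normalised) Filter.atTop (𝓝 B.spec) ∧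
      Filter.Tendsto (fun j => (lam j).normalised) Filter.atTop (𝓝 c) := by
  have hanti : ∀ (A : DensityOperator d) (x : ℝ), 0 < x →
      Antitone fun i => ⌊A.spec i * x⌋₊ := fun A x hx i j hij =>
    Nat.floor_le_floor (mul_le_mul_of_nonneg_right (A.spec_antitone hij) hx.le)
  choose μ hμ using fun j => exists_youngFrame (hanti A (M j) (hM0 j))
  choose ν hν using fun j => exists_youngFrame (hanti B (N j) (hN0 j))
  -- Sums of floors, not floors of sums, so that λ = μ + ν holds exactly.
  choose lam hlam using fun j => exists_youngFrame
    ((hanti A (M j) (hM0 j)).add (hanti B (N j) (hN0 j)))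
  have hA : ∀ i : Fin d, Filter.Tendsto (fun j => ((μ j).1.rowLen i : ℝ) / M j) Filter.atTop
      (𝓝 (A.spec i)) := fun i => by
    simp only [hμ]
    exact (tendsto_nat_floor_mul_div_atTop (A.spec_nonneg i)).comp hM
  have hB : ∀ i : Fin d, Filter.Tendsto (fun j => ((ν j).1.rowLen i : ℝ) / N j) Filter.atTop
      (𝓝 (B.spec i)) := fun i => by
    simp only [hν]
    exact (tendsto_nat_floor_mul_div_atTop (B.spec_nonneg i)).comp hN
  have hadd : ∀ j (i : Fin d), (lam j).1.rowLen i = (μ j).1.rowLen i + (ν j).1.rowLen i :=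
    fun j i => by rw [hlam, hμ, hν]
  refine ⟨μ, ν, lam, fun j => littlewoodRichardson_add_ne_zero (hadd j),
    tendsto_normalised A.sum_spec hM0 hA, tendsto_normalised B.sum_spec hN0 hB,
    tendsto_normalised hc (N := fun j => M j + N j) (fun j => add_pos (hM0 j) (hN0 j)) fun i => ?_⟩
  rw [hcA]
  refine (((hA i).mul ht).add ((hB i).mul hu)).congr fun j => ?_
  have h1 := (hM0 j).ne'
  have h2 := (hN0 j).ne'
  rw [hadd, div_mul_div_cancel₀ h1, div_mul_div_cancel₀ h2, Nat.cast_add, add_div]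

lemma tendsto_sq_div_sq_add :
    Filter.Tendsto (fun j : ℕ => ((j : ℝ) + 1) ^ 2 / (((j : ℝ) + 1) ^ 2 + ((j : ℝ) + 1)))
      Filter.atTop (𝓝 1) ∧
    Filter.Tendsto (fun j : ℕ => ((j : ℝ) + 1) / (((j : ℝ) + 1) ^ 2 + ((j : ℝ) + 1)))
      Filter.atTop (𝓝 0) := by
  have h0 : Filter.Tendsto (fun j : ℕ => 1 / (((j + 1 : ℕ) : ℝ) + 1)) Filter.atTop (𝓝 0) :=
    (tendsto_one_div_add_atTop_nhds_zero_nat (𝕜 := ℝ)).comp (Filter.tendsto_add_atTop_nat 1)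
  have h1 := h0.const_sub 1
  rw [sub_zero] at h1
  constructor
  · refine h1.congr fun j => ?_
    have : (j : ℝ) + 1 ≠ 0 := by positivity
    have : (j : ℝ) + 1 + 1 ≠ 0 := by positivity
    push_cast
    field_simp
    ring
  · refine h0.congr fun j => ?_
    have : (j : ℝ) + 1 ≠ 0 := by positivity
    have : (j : ℝ) + 1 + 1 ≠ 0 := by positivity
    push_cast
    field_simp

end Existence

end

theorem mainTheorem6 (d : ℕ) (p : Set.Icc (0 : ℝ) 1) (A B : DensityOperator d) :
    ∃ μ ν lam : ℕ → YoungFrame d,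
      (∀ j, littlewoodRichardson (μ j) (ν j) (lam j) ≠ 0) ∧
      Filter.Tendsto (fun j => (μ j).normalised) Filter.atTop (𝓝 A.spec) ∧
      Filter.Tendsto (fun j => (ν j).normalised) Filter.atTop (𝓝 B.spec) ∧
      Filter.Tendsto (fun j => (lam j).normalised) Filter.atTop
        (𝓝 (DensityOperator.mix p A B).spec) := by
  have hlin : ∀ j : ℕ, (0 : ℝ) < (j : ℝ) + 1 := fun j => by positivity
  have hsq : ∀ j : ℕ, (0 : ℝ) < ((j : ℝ) + 1) ^ 2 := fun j => by positivity
  have hlin' : Filter.Tendsto (fun j : ℕ => (j : ℝ) + 1) Filter.atTop Filter.atTop :=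
    Filter.tendsto_atTop_add_const_right _ _ tendsto_natCast_atTop_atTop
  have hsq' : Filter.Tendsto (fun j : ℕ => ((j : ℝ) + 1) ^ 2) Filter.atTop Filter.atTop :=
    (Filter.tendsto_pow_atTop two_ne_zero).comp hlin'
  rcases p.2.1.eq_or_lt with hp0 | hp0
  -- The frame for A grows linearly and that for B quadratically, so both normalised limits are
  -- correct while the sum is governed by B alone.
  · have hmix : (DensityOperator.mix p A B).toMatrix = B.toMatrix := by
      simp [DensityOperator.mix, ← hp0]
    have hspec : (DensityOperator.mix p A B) = B := by
      cases B
      cases h : DensityOperator.mix p A _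
      simp_all
    rw [hspec]
    refine exists_cartan_sequences A B B.sum_spec hlin hsq hlin' hsq' (t := 0) (u := 1) ?_ ?_
      fun i => by ring
    · simpa only [add_comm] using tendsto_sq_div_sq_add.2
    · simpa only [add_comm] using tendsto_sq_div_sq_add.1
  rcases p.2.2.eq_or_lt with hp1 | hp1
  · have hmix : (DensityOperator.mix p A B).toMatrix = A.toMatrix := by
      simp [DensityOperator.mix, hp1]
    have hspec : (DensityOperator.mix p A B) = A := by
      cases A
      cases h : DensityOperator.mix p _ B
      simp_all
    rw [hspec]
    exact exists_cartan_sequences A B A.sum_spec hsq hlin hsq' hlin' (t := 1) (u := 0)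
      tendsto_sq_div_sq_add.1 tendsto_sq_div_sq_add.2 fun i => by ring
  choose μ ν lam hμ hν hlam hLR using fun j : ℕ =>
    exists_near_littlewoodRichardson_ne_zero p hp0 hp1 A B
      (Nat.one_div_pos_of_nat : 0 < 1 / ((j : ℝ) + 1))
  exact ⟨μ, ν, lam, hLR, tendsto_normalised_of_isNear hμ, tendsto_normalised_of_isNear hν,
    tendsto_normalised_of_isNear hlam⟩
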